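/- **Conventions.** Let $E,F$ be (real) Banach lattices. The dual $E^*$ is ordered by $\varphi\le\psi$ iff $\varphi(x)\le\psi(x)$ for all $x\ge 0$; the bidual $E^{**}=(E^*)^*$ is ordered in the same way over $E^*$, and likewise for $F$. A map $P\colon E\to F$ is an *$m$-homogeneous polynomial* if $P(x)=\check P(x,\dots,x)$ for a (necessarily unique) symmetric $m$-linear operator $\check P\colon E^m\to F$; it is *positive* if $\check P(x_1,\dots,x_m)\ge 0$ whenever $x_1,\dots,x_m\ge 0$, and *regular*, written $P\in\mathcal P_r({}^mE;F)$, if it is the difference of two positive $m$-homogeneous polynomials (then $\check P$ is continuous). $P$ is *orthogonally additive* if $P(x+y)=P(x)+P(y)$ whenever $|x|\wedge|y|=0$. For a continuous $m$-linear form $A$ on $E^m$ and $x_1'',\dots,x_m''\in E^{**}$, put $$\overline{x_m''}(A)(x_1,\dots,x_{m-1})=x_m''\big(A(x_1,\dots,x_{m-1},\bullet)\big),$$ a continuous $(m-1)$-linear form; apply $\overline{x_{m-1}''}$ to it, and so on down to $\overline{x_1''}$, to obtain the number $A^{*[m+1]}(x_1'',\dots,x_m'')=(\overline{x_1''}\circ\cdots\circ\overline{x_m''})(A)$.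 For a continuous $m$-linear operator $A\colon E^m\to F$, the Arens extension $A^{*[m+1]}\colon (E^{**})^m\to F^{**}$ is given by $A^{*[m+1]}(x_1'',\dots,x_m'')(\varphi)=(\varphi\circ A)^{*[m+1]}(x_1'',\dots,x_m'')$ for $\varphi\in F^*$. For $P\in\mathcal P_r({}^mE;F)$, put $P^{*[m+1]}(x'')=(\check P)^{*[m+1]}(x'',\dots,x'')$ for $x''\in E^{**}$. $E$ is *symmetrically Arens regular* if every bounded linear operator $u\colon E\to E^*$ with $u(x)(y)=u(y)(x)$ for all $x,y\in E$ is weakly compact. A net $(x_\alpha)_{\alpha\in\Omega}$ in a Riesz space is *order convergent* to $x$ if there is a net $(y_\alpha)_{\alpha\in\Omega}$ with $y_\alpha\downarrow 0$ and $|x_\alpha-x|\le y_\alpha$ for all $\alpha$; it is *1-convergent* to $x$ if there are such a net $y_\alpha\downarrow0$ and $\alpha_0\in\Omega$ with $|x_\alpha-x|\le y_\alpha$ for all $\alpha\ge\alpha_0$; it is *2-convergent* to $x$ if there is a net $(y_\beta)_{\beta\in\Gamma}$, $y_\beta\downarrow 0$, such that for every $\beta$ there is $\alpha_0$ with $|x_\alpha-x|\le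 y_\beta$ for all $\alpha\ge\alpha_0$. A map $f$ between Riesz spaces is *order continuous at $x$* in one of these three senses if $(f(x_\alpha))$ converges to $f(x)$ in that sense for every net $(x_\alpha)$ that converges to $x$ in that sense. **Proposition.** Let $E,F$ be Banach lattices and $P\in\mathcal P_r({}^mE;F)$. If either $P$ is orthogonally additive and $F=\mathbb R$, or $E$ is symmetrically Arens regular, then the Arens extension $P^{*[m+1]}\colon E^{**}\to F^{**}$ is order continuous at every point of $E^{**}$, in each of the three senses above. -/

import Mathlib

/-!
Banach lattices are represented by Mathlib's classes: a real Banach space that is a lattice ordered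
vector space whose norm is solid, that is, `|x| ≤ |y|` implies `‖x‖ ≤ ‖y‖`.
-/

universe w u v

noncomputable section

/-! ### Order convergence and order continuity -/

section OrderConvergence

/-- `y_α ↓ 0`: the net `y` is decreasing and its infimum is `0`. -/
def DecreasesToZero {Ω V : Type*} [Preorder Ω] [Zero V] [Preorder V] (y : Ω → V) : Prop :=
  Antitone y ∧ IsGLB (Set.range y) 0

/-- `|v| ≤ y`, written as `-y ≤ v ≤ y` (equivalent to it in every Riesz space). -/
def AbsLE {V : Type*} [AddCommGroup V] [Preorder V] (v y : V) : Prop :=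
  -y ≤ v ∧ v ≤ y

variable {V W : Type*} [AddCommGroup V] [Preorder V] [AddCommGroup W] [Preorder W]

/-- Order convergence of the net `x` to `l`: `|x_α - l| ≤ y_α` for all `α`, where `y_α ↓ 0`. -/
def OrderConvergent {Ω : Type*} [Preorder Ω] (x : Ω → V) (l : V) : Prop :=
  ∃ y : Ω → V, DecreasesToZero y ∧ ∀ α, AbsLE (x α - l) (y α)

/-- 1-convergence of the net `x` to `l`: `|x_α - l| ≤ y_α` for all `α ≥ α₀`, where `y_α ↓ 0`. -/
def OneConvergent {Ω : Type*} [Preorder Ω] (x : Ω → V) (l : V) : Prop :=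
  ∃ (y : Ω → V) (α₀ : Ω), DecreasesToZero y ∧ ∀ α, α₀ ≤ α → AbsLE (x α - l) (y α)

/-- 2-convergence of the net `x` to `l`: there is a net `y_β ↓ 0`, possibly over another directed
set, each member of which eventually dominates `|x_α - l|`. -/
def TwoConvergent {V : Type u} [AddCommGroup V] [Preorder V] {Ω : Type w} [Preorder Ω]
    (x : Ω → V) (l : V) : Prop :=
  ∃ (Γ : Type w) (_ : Preorder Γ) (_ : IsDirectedOrder Γ) (_ : Nonempty Γ) (y : Γ → V),
    DecreasesToZero y ∧ ∀ β, ∃ α₀ : Ω, ∀ α, α₀ ≤ α → AbsLE (x α - l) (y β)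

/-- `f` is order continuous at `a`, for order convergence of nets. -/
def OrderContinuousAt {V : Type u} {W : Type v} [AddCommGroup V] [Preorder V]
    [AddCommGroup W] [Preorder W] (f : V → W) (a : V) : Prop :=
  ∀ (Ω : Type w) [Preorder Ω] [IsDirectedOrder Ω] [Nonempty Ω] (x : Ω → V),
    OrderConvergent x a → OrderConvergent (fun α => f (x α)) (f a)

/-- `f` is 1-order continuous at `a`. -/
def OneOrderContinuousAt {V : Type u} {W : Type v} [AddCommGroup V] [Preorder V]
    [AddCommGroup W] [Preorder W] (f : V → W) (a : V) : Prop :=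
  ∀ (Ω : Type w) [Preorder Ω] [IsDirectedOrder Ω] [Nonempty Ω] (x : Ω → V),
    OneConvergent x a → OneConvergent (fun α => f (x α)) (f a)

/-- `f` is 2-order continuous at `a`. -/
def TwoOrderContinuousAt {V : Type u} {W : Type v} [AddCommGroup V] [Preorder V]
    [AddCommGroup W] [Preorder W] (f : V → W) (a : V) : Prop :=
  ∀ (Ω : Type w) [Preorder Ω] [IsDirectedOrder Ω] [Nonempty Ω] (x : Ω → V),
    TwoConvergent x a → TwoConvergent (fun α => f (x α)) (f a)

end OrderConvergence

/-! ### The dual and the bidual with their order -/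

section Dual

/-- The topological dual `E*`, as a type of its own: it carries the dual order below. -/
def BanachDual (E : Type*) [NormedAddCommGroup E] [NormedSpace ℝ E] : Type _ :=
  StrongDual ℝ E

variable {E : Type*} [NormedAddCommGroup E] [NormedSpace ℝ E]

instance : NormedAddCommGroup (BanachDual E) :=
  inferInstanceAs (NormedAddCommGroup (StrongDual ℝ E))

instance : NormedSpace ℝ (BanachDual E) :=
  inferInstanceAs (NormedSpace ℝ (StrongDual ℝ E))

instance : FunLike (BanachDual E) E ℝ :=
  inferInstanceAs (FunLike (StrongDual ℝ E) E ℝ)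

instance : ContinuousLinearMapClass (BanachDual E) ℝ E ℝ :=
  inferInstanceAs (ContinuousLinearMapClass (StrongDual ℝ E) ℝ E ℝ)

/-- The dual order: `φ ≤ ψ` if and only if `φ x ≤ ψ x` for all `x ≥ 0`. (It is antisymmetric as soon
as the positive cone of `E` spans `E`, in particular for Banach lattices and their duals.) -/
instance [Preorder E] : Preorder (BanachDual E) where
  le φ ψ := ∀ x : E, 0 ≤ x → φ x ≤ ψ x
  le_refl _ _ _ := le_rfl
  le_trans _ _ _ h₁ h₂ x hx := (h₁ x hx).trans (h₂ x hx)

/-- The bidual `E**`, with the order dual to that of `E*`. -/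
abbrev Bidual (E : Type*) [NormedAddCommGroup E] [NormedSpace ℝ E] : Type _ :=
  BanachDual (BanachDual E)

end Dual

/-! ### Regular homogeneous polynomials -/

section Polynomials

variable {E F : Type*} {m : ℕ}
  [NormedAddCommGroup E] [NormedSpace ℝ E] [NormedAddCommGroup F] [NormedSpace ℝ F]

/-- The `m`-linear operator `A` is symmetric. -/
def IsSymmetricMultilinear (A : MultilinearMap ℝ (fun _ : Fin m => E) F) : Prop :=
  ∀ (σ : Equiv.Perm (Fin m)) (x : Fin m → E), A (fun i => x (σ i)) = A x

/-- `A` is the symmetric `m`-linear operator associated to `P : E → F`; by polarization there is at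
most one, and `P` is an `m`-homogeneous polynomial if and only if there is one. -/
def IsAssociatedTo (A : MultilinearMap ℝ (fun _ : Fin m => E) F) (P : E → F) : Prop :=
  IsSymmetricMultilinear A ∧ ∀ x, P x = A (fun _ => x)

/-- The `m`-linear operator `A` is positive. -/
def IsPositiveMultilinear [Preorder E] [Preorder F]
    (A : MultilinearMap ℝ (fun _ : Fin m => E) F) : Prop :=
  ∀ x : Fin m → E, (∀ i, 0 ≤ x i) → 0 ≤ A x

/-- `P` is a positive `m`-homogeneous polynomial: its symmetric `m`-linear operator is positive. -/
def IsPositivePolynomial [Preorder E] [Preorder F] (m : ℕ) (P : E → F) : Prop :=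
  ∃ A : MultilinearMap ℝ (fun _ : Fin m => E) F, IsAssociatedTo A P ∧ IsPositiveMultilinear A

/-- `P` is a regular `m`-homogeneous polynomial: a difference of two positive ones. -/
def IsRegularPolynomial [Preorder E] [Preorder F] (m : ℕ) (P : E → F) : Prop :=
  ∃ P₁ P₂ : E → F, IsPositivePolynomial m P₁ ∧ IsPositivePolynomial m P₂ ∧
    ∀ x, P x = P₁ x - P₂ x

/-- `P` is orthogonally additive: it is additive on pairs of disjoint vectors. -/
def IsOrthogonallyAdditive {E F : Type*} [AddCommGroup E] [Lattice E] [Add F] (P : E → F) : Prop :=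
  ∀ x y : E, |x| ⊓ |y| = 0 → P (x + y) = P x + P y

end Polynomials

/-! ### Positive multilinear operators between Banach lattices are continuous -/

section Continuity

variable {E F : Type*} {m : ℕ}
  [NormedAddCommGroup E] [NormedSpace ℝ E] [Lattice E] [IsOrderedAddMonoid E]
  [IsOrderedModule ℝ E] [HasSolidNorm E]
  [NormedAddCommGroup F] [NormedSpace ℝ F] [Lattice F] [IsOrderedAddMonoid F] [HasSolidNorm F]

theorem IsPositiveMultilinear.mono {E F : Type*} {m : ℕ}
    [NormedAddCommGroup E] [NormedSpace ℝ E] [Lattice E] [IsOrderedAddMonoid E]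
    [NormedAddCommGroup F] [NormedSpace ℝ F] [Lattice F] [IsOrderedAddMonoid F]
    {A : MultilinearMap ℝ (fun _ : Fin m => E) F}
    (hA : IsPositiveMultilinear A) {x z : Fin m → E} (hx : ∀ i, 0 ≤ x i) (hxz : ∀ i, x i ≤ z i) :
    A x ≤ A z := by
  classical
  have h : A (x + (z - x)) = ∑ s : Finset (Fin m), A (s.piecewise x (z - x)) := A.map_add_univ _ _
  rw [add_sub_cancel] at h
  rw [h]
  have h1 : A x = A ((Finset.univ : Finset (Fin m)).piecewise x (z - x)) := by simp
  rw [h1]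
  refine Finset.single_le_sum (f := fun s : Finset (Fin m) => A (s.piecewise x (z - x)))
    (fun s _ => hA _ fun i => ?_) (Finset.mem_univ _)
  by_cases hi : i ∈ s
  · simpa [hi] using hx i
  · simpa [hi] using hxz i

theorem IsPositiveMultilinear.exists_bound_nonneg [CompleteSpace E]
    {A : MultilinearMap ℝ (fun _ : Fin m => E) F} (hA : IsPositiveMultilinear A) :
    ∃ C : ℝ, ∀ x : Fin m → E, (∀ i, 0 ≤ x i) → (∀ i, ‖x i‖ ≤ 1) → ‖A x‖ ≤ C := by
  by_contra! hcon
  choose x hx0 hx1 hxA using fun n : ℕ => hcon (n * (2 ^ n) ^ m)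
  have hsum : ∀ i, Summable fun n : ℕ => ((1 / 2 : ℝ) ^ n) • x n i := fun i => by
    refine Summable.of_norm_bounded (g := fun n : ℕ => (1 / 2 : ℝ) ^ n)
      summable_geometric_two fun n => ?_
    rw [norm_smul, Real.norm_of_nonneg (by positivity)]
    exact mul_le_of_le_one_right (by positivity) (hx1 n i)
  set z : Fin m → E := fun i => ∑' n : ℕ, ((1 / 2 : ℝ) ^ n) • x n i with hz
  have hle : ∀ n i, ((1 / 2 : ℝ) ^ n) • x n i ≤ z i := fun n i =>
    (hsum i).le_tsum n fun k _ => smul_nonneg (by positivity) (hx0 k i)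
  obtain ⟨n, hn⟩ := exists_nat_gt ‖A z‖
  have h0 : ∀ i, 0 ≤ ((1 / 2 : ℝ) ^ n) • x n i := fun i => smul_nonneg (by positivity) (hx0 n i)
  have h2 := hA.mono h0 (hle n)
  have h3 : ‖A fun i => ((1 / 2 : ℝ) ^ n) • x n i‖ ≤ ‖A z‖ := by
    have h4 := hA _ h0
    exact norm_le_norm_of_abs_le_abs (by rwa [abs_of_nonneg h4, abs_of_nonneg (h4.trans h2)])
  rw [A.map_smul_univ (fun _ => (1 / 2 : ℝ) ^ n) (x n), norm_smul, Finset.prod_const,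
    Finset.card_univ, Fintype.card_fin, Real.norm_of_nonneg (by positivity)] at h3
  have h5 : ((1 / 2 : ℝ) ^ n) ^ m * (n * (2 ^ n) ^ m) = n := by
    rw [mul_left_comm, ← mul_pow, ← mul_pow]; norm_num
  have h6 := mul_le_mul_of_nonneg_left (hxA n).le
    (show (0 : ℝ) ≤ ((1 / 2 : ℝ) ^ n) ^ m by positivity)
  rw [h5] at h6
  linarith

theorem IsPositiveMultilinear.continuous [CompleteSpace E]
    {A : MultilinearMap ℝ (fun _ : Fin m => E) F} (hA : IsPositiveMultilinear A) :
    Continuous A := by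
  classical
  obtain ⟨C, hC⟩ := hA.exists_bound_nonneg
  have key : ∀ x : Fin m → E, (∀ i, ‖x i‖ ≤ 1) → ‖A x‖ ≤ 2 ^ m * C := fun x hx => by
    have h : A ((fun i => (x i)⁺) + fun i => -(x i)⁻) = ∑ s : Finset (Fin m),
        A (s.piecewise (fun i => (x i)⁺) fun i => -(x i)⁻) := A.map_add_univ _ _
    have hx' : ((fun i => (x i)⁺) + fun i => -(x i)⁻) = x := by
      ext i
      simp [← sub_eq_add_neg, posPart_sub_negPart]
    rw [hx'] at h
    rw [h]
    refine (norm_sum_le _ _).trans ?_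
    have hs : ∀ s ∈ (Finset.univ : Finset (Finset (Fin m))),
        ‖A (s.piecewise (fun i => (x i)⁺) fun i => -(x i)⁻)‖ ≤ C := fun s _ => by
      have hp : (s.piecewise (fun i => (x i)⁺) fun i => -(x i)⁻) = fun i =>
          (if i ∈ s then (1 : ℝ) else -1) • (if i ∈ s then (x i)⁺ else (x i)⁻) := by
        ext i
        by_cases hi : i ∈ s <;> simp [hi]
      rw [hp, A.map_smul_univ, norm_smul, Real.norm_eq_abs, Finset.abs_prod,
        Finset.prod_eq_one (fun i _ => by split_ifs <;> simp), one_mul]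
      refine hC _ (fun i => ?_) fun i => ?_
      · split_ifs
        exacts [posPart_nonneg _, negPart_nonneg _]
      · refine le_trans ?_ (hx i)
        have h1 : 0 ≤ (x i)⁺ := posPart_nonneg _
        have h2 : 0 ≤ (x i)⁻ := negPart_nonneg _
        have h3 := posPart_add_negPart (x i)
        split_ifs
        · exact norm_le_norm_of_abs_le_abs (by
            rw [abs_of_nonneg h1, ← h3]; exact le_add_of_nonneg_right h2)
        · exact norm_le_norm_of_abs_le_abs (by
            rw [abs_of_nonneg h2, ← h3]; exact le_add_of_nonneg_left h1)
    refine (Finset.sum_le_card_nsmul _ _ _ hs).trans_eq ?_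
    simp
  refine A.continuous_of_bound (2 ^ m * C) fun x => ?_
  by_cases hx : ∃ i, x i = 0
  · obtain ⟨i, hi⟩ := hx
    rw [A.map_coord_zero i hi, Finset.prod_eq_zero (Finset.mem_univ i) (by simp [hi])]
    simp
  · push Not at hx
    have h1 : x = fun i => ‖x i‖ • (‖x i‖⁻¹ • x i) := by
      ext i
      rw [smul_inv_smul₀ (norm_ne_zero_iff.mpr (hx i))]
    have h2 := key (fun i => ‖x i‖⁻¹ • x i) fun i => by
      rw [norm_smul, norm_inv, norm_norm, inv_mul_cancel₀ (norm_ne_zero_iff.mpr (hx i))]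
    conv_lhs => rw [h1]
    rw [A.map_smul_univ, norm_smul, Real.norm_of_nonneg (by positivity), mul_comm]
    exact mul_le_mul_of_nonneg_right h2 (by positivity)
/-- The symmetric `m`-linear operator of a regular polynomial exists and is continuous. -/
theorem IsRegularPolynomial.exists_continuousMultilinearMap [CompleteSpace E] {P : E → F}
    (hP : IsRegularPolynomial m P) :
    ∃ A : ContinuousMultilinearMap ℝ (fun _ : Fin m => E) F,
      IsAssociatedTo A.toMultilinearMap P := by
  obtain ⟨P₁, P₂, ⟨A₁, ⟨hs₁, h₁⟩, hA₁⟩, ⟨A₂, ⟨hs₂, h₂⟩, hA₂⟩, h⟩ := hP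
  refine ⟨⟨A₁ - A₂, hA₁.continuous.sub hA₂.continuous⟩, fun σ x => ?_, fun x => ?_⟩
  · simp [hs₁ σ x, hs₂ σ x]
  · simp [h, h₁, h₂]

/-- The symmetric `m`-linear operator `P̌ : E × ⋯ × E → F` associated to a regular `m`-homogeneous
polynomial `P`, so that `P x = P̌ (x, …, x)`. -/
def IsRegularPolynomial.symmetricOperator [CompleteSpace E] {P : E → F}
    (hP : IsRegularPolynomial m P) : ContinuousMultilinearMap ℝ (fun _ : Fin m => E) F :=
  hP.exists_continuousMultilinearMap.choose

theorem IsRegularPolynomial.symmetricOperator_isAssociatedTo [CompleteSpace E] {P : E → F}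
    (hP : IsRegularPolynomial m P) : IsAssociatedTo hP.symmetricOperator.toMultilinearMap P :=
  hP.exists_continuousMultilinearMap.choose_spec

end Continuity

/-! ### Arens extensions -/

section Arens

variable {E F : Type*}
  [NormedAddCommGroup E] [NormedSpace ℝ E] [NormedAddCommGroup F] [NormedSpace ℝ F]

/-- The operator `A ↦ ((x₁, …, xₙ) ↦ x'' (A (x₁, …, xₙ, •)))` from `(n+1)`-linear to `n`-linear forms
that is induced by `x'' ∈ E**`. -/
def arensStep (n : ℕ) (x'' : Bidual E) :
    ContinuousMultilinearMap ℝ (fun _ : Fin (n + 1) => E) ℝ →L[ℝ]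
      ContinuousMultilinearMap ℝ (fun _ : Fin n => E) ℝ :=
  (ContinuousLinearMap.compContinuousMultilinearMapL ℝ (fun _ : Fin n => E) (StrongDual ℝ E) ℝ
    (show StrongDual ℝ (StrongDual ℝ E) from x'')).comp
    (continuousMultilinearCurryRightEquiv' ℝ n E ℝ :
      ContinuousMultilinearMap ℝ (fun _ : Fin (n + 1) => E) ℝ →L[ℝ] _)

theorem arensStep_apply (n : ℕ) (x'' : Bidual E)
    (A : ContinuousMultilinearMap ℝ (fun _ : Fin (n + 1) => E) ℝ) (x : Fin n → E) :
    arensStep n x'' A x = x'' (A.curryRight x : StrongDual ℝ E) := rfl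

/-- `A ↦ A^{*[m+1]} (x₁'', …, xₘ'')` for continuous `m`-linear forms `A`: the functional `xₘ''` acts
on the last variable of `A`, then `xₘ₋₁''` on the last remaining one, and so on down to `x₁''`. -/
def arensForm : (m : ℕ) → (Fin m → Bidual E) →
    ContinuousMultilinearMap ℝ (fun _ : Fin m => E) ℝ →L[ℝ] ℝ
  | 0, _ => ContinuousMultilinearMap.apply ℝ (fun _ : Fin 0 => E) ℝ 0
  | n + 1, x'' => (arensForm n fun i => x'' i.castSucc).comp (arensStep n (x'' (Fin.last n)))

/-- The Arens extension `A^{*[m+1]} : E** × ⋯ × E** → F**` of a continuous `m`-linear operator `A`: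
its value at `(x₁'', …, xₘ'')` is the functional `φ ↦ (φ ∘ A)^{*[m+1]} (x₁'', …, xₘ'')` on `F*`. -/
def arensExtension {m : ℕ} (A : ContinuousMultilinearMap ℝ (fun _ : Fin m => E) F)
    (x'' : Fin m → Bidual E) : Bidual F :=
  show StrongDual ℝ (StrongDual ℝ F) from
    (arensForm m x'').comp
      ((ContinuousLinearMap.compContinuousMultilinearMapL ℝ (fun _ : Fin m => E) F ℝ).flip A)

theorem arensExtension_apply {m : ℕ} (A : ContinuousMultilinearMap ℝ (fun _ : Fin m => E) F)
    (x'' : Fin m → Bidual E) (φ : StrongDual ℝ F) :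
    arensExtension A x'' (φ : BanachDual F) =
      arensForm m x'' (φ.compContinuousMultilinearMap A) := rfl

/-- The Arens extension `P^{*[m+1]} : E** → F**` of a regular `m`-homogeneous polynomial `P`. -/
def IsRegularPolynomial.arensExtension {m : ℕ} [Lattice E] [IsOrderedAddMonoid E]
    [IsOrderedModule ℝ E] [HasSolidNorm E] [CompleteSpace E] [Lattice F] [IsOrderedAddMonoid F]
    [HasSolidNorm F] {P : E → F} (hP : IsRegularPolynomial m P) (x'' : Bidual E) : Bidual F :=
  _root_.arensExtension hP.symmetricOperator fun _ => x''

end Arens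

/-! ### Symmetric Arens regularity -/

section SymmetricArensRegularity

/-- The operator `u` is weakly compact: the image of the closed unit ball is relatively compact in
the weak topology. -/
def IsWeaklyCompactOperator {X Y : Type*} [NormedAddCommGroup X] [NormedSpace ℝ X]
    [NormedAddCommGroup Y] [NormedSpace ℝ Y] (u : X →L[ℝ] Y) : Prop :=
  IsCompact (closure (toWeakSpace ℝ Y '' (u '' Metric.closedBall 0 1)))

/-- `X` is symmetrically Arens regular: every symmetric operator from `X` to `X*` is weakly compact. -/
def IsSymmetricallyArensRegular (X : Type*) [NormedAddCommGroup X] [NormedSpace ℝ X] : Prop :=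
  ∀ u : X →L[ℝ] StrongDual ℝ X, (∀ x y : X, u x y = u y x) → IsWeaklyCompactOperator u

end SymmetricArensRegularity

end

noncomputable section

open Filter Topology

/-! ### The order dual of a normed space with a monotone norm -/

section Dual

variable {G : Type*} [NormedAddCommGroup G] [NormedSpace ℝ G]

/-! Write `A` for the symmetric operator of `P` and `C` for a positive operator dominating it. Fix
`a` in the bidual and `U` with `|a| ≤ U`. If `|x - a| ≤ y`, then `x` and `a` are both bounded by `V
= U + y`. Telescoping the difference of the values of the extended `A` at `(x, …, x)` and `(a, …,
a)` gives `m` terms, each with one entry `x - a`. If that entry can be moved to the first slot, each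
term is at most the value of the extended `C` at `(y, V, …, V)`. The increment of the extension at
`a` is thus bounded by a modulus `D(y)`, `m` times that value.

The first slot is special because its functional acts last: once `φ ≥ 0` and the tail are fixed, the
value is `y(ψ)` for a fixed positive `ψ` in `E*`. A net `y ↓ 0` in the bidual converges to `0` at
every positive `ψ`, and the tails decrease with `y`, so `D(y) ↓ 0`. Since `D` depends only on `y`,
the three senses of order continuity follow together (`orderContinuousAt_of_modulus`).

Moving an entry to the first slot requires that bidual elements acting on the last two variables may
be interchanged, for every form met during the telescoping. This concerns the bilinear forms `B`
obtained by fixing the other variables, and `IsArensSymmetricFamily` isolates it. If `E` is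
symmetrically Arens regular, `B` is a symmetric weakly compact operator, and a separation argument
gives the interchange.

If `P` is orthogonally additive and scalar valued, `A` vanishes on tuples containing two disjoint
vectors, so `B` is orthosymmetric. It has a dominating orthosymmetric form `D`, which may be taken
symmetric. Then `D + B` and `D - B` are positive semidefinite, because the cross terms of `x = x⁺ -
x⁻` vanish. A positive semidefinite form factors through a Hilbert space, where the interchange is
the symmetry of the inner product. -/

@[simp] theorem BanachDual.add_apply (φ ψ : BanachDual G) (x : G) : (φ + ψ) x = φ x + ψ x := rfl

@[simp] theorem BanachDual.sub_apply (φ ψ : BanachDual G) (x : G) : (φ - ψ) x = φ x - ψ x := rfl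

@[simp] theorem BanachDual.neg_apply (φ : BanachDual G) (x : G) : (-φ) x = -φ x := rfl

@[simp] theorem BanachDual.zero_apply (x : G) : (0 : BanachDual G) x = 0 := rfl

theorem BanachDual.abs_apply_le (φ : BanachDual G) (x : G) : |φ x| ≤ ‖φ‖ * ‖x‖ :=
  ContinuousLinearMap.le_opNorm (show StrongDual ℝ G from φ) x

theorem BanachDual.norm_le_of_abs_le (φ : BanachDual G) {c : ℝ} (hc : 0 ≤ c)
    (h : ∀ x, |φ x| ≤ c * ‖x‖) : ‖φ‖ ≤ c :=
  ContinuousLinearMap.opNorm_le_bound (show StrongDual ℝ G from φ) hc h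

/-- A normed space with a convex cone of positive elements on which the norm is monotone. -/
class MonotoneNorm (G : Type*) [NormedAddCommGroup G] [NormedSpace ℝ G] [Preorder G] : Prop where
  add_nonneg' : ∀ {x y : G}, 0 ≤ x → 0 ≤ y → 0 ≤ x + y
  smul_nonneg' : ∀ {c : ℝ} {x : G}, 0 ≤ c → 0 ≤ x → 0 ≤ c • x
  norm_le_norm_add : ∀ {x y : G}, 0 ≤ x → 0 ≤ y → ‖x‖ ≤ ‖x + y‖

theorem BanachDual.abs_apply_le_apply_abs {E : Type*} [NormedAddCommGroup E] [NormedSpace ℝ E]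
    [Lattice E] [IsOrderedAddMonoid E] {φ : BanachDual E} (hφ : 0 ≤ φ) (x : E) :
    |φ x| ≤ φ |x| := by
  have h1 : 0 ≤ φ (|x| - x) := hφ _ (sub_nonneg.2 (le_abs_self x))
  have h2 : 0 ≤ φ (|x| + x) := hφ _ (by
    have := neg_le_abs x
    rwa [neg_le_iff_add_nonneg] at this)
  rw [map_sub] at h1
  rw [map_add] at h2
  exact abs_le.2 ⟨by linarith, by linarith⟩

instance (priority := 900) monotoneNorm_of_hasSolidNorm {E : Type*} [NormedAddCommGroup E]
    [NormedSpace ℝ E] [Lattice E] [IsOrderedAddMonoid E] [IsOrderedModule ℝ E] [HasSolidNorm E] :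
    MonotoneNorm E where
  add_nonneg' := add_nonneg
  smul_nonneg' := smul_nonneg
  norm_le_norm_add hx hy := norm_le_norm_of_abs_le_abs (by
    rw [abs_of_nonneg hx, abs_of_nonneg (add_nonneg hx hy)]
    exact le_add_of_nonneg_right hy)

/-- For positive functionals, `|φ x| ≤ φ |x| ≤ (φ + ψ) |x|`, and `|x|` has the norm of `x`. With
this instance the facts below apply to functionals on `E*` as well as on `E`, using only the cone
and the norm of `E*`. -/
instance monotoneNorm_banachDual {E : Type*} [NormedAddCommGroup E]
    [NormedSpace ℝ E] [Lattice E] [IsOrderedAddMonoid E] [HasSolidNorm E] :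
    MonotoneNorm (BanachDual E) where
  add_nonneg' hx hy z hz := by
    have h1 := hx z hz
    have h2 := hy z hz
    simp only [BanachDual.zero_apply, BanachDual.add_apply] at *
    linarith
  smul_nonneg' hc hx z hz := mul_nonneg hc (hx z hz)
  norm_le_norm_add {φ ψ} hφ hψ := by
    refine φ.norm_le_of_abs_le (norm_nonneg _) fun x => ?_
    have h1 : 0 ≤ ψ |x| := hψ _ (abs_nonneg x)
    have h2 := (φ + ψ).abs_apply_le |x|
    rw [norm_abs_eq_norm] at h2
    refine le_trans ?_ ((le_abs_self _).trans h2)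
    have := BanachDual.abs_apply_le_apply_abs hφ x
    simp only [BanachDual.add_apply]
    linarith

variable [Preorder G] [MonotoneNorm G]

open MonotoneNorm in
/-- Every functional on a space with a monotone norm is dominated by a positive functional of no
larger norm. -/
theorem BanachDual.exists_nonneg_ge (f : BanachDual G) :
    ∃ g : BanachDual G, 0 ≤ g ∧ f ≤ g ∧ ‖g‖ ≤ ‖f‖ := by
  let K := {p : G × G // 0 ≤ p.1 ∧ 0 ≤ p.2}
  have : Nonempty K := ⟨⟨0, le_rfl, le_rfl⟩⟩
  -- Subtracting `k ≥ 0` must not increase `g` and subtracting `h ≥ 0` must lower it by at least `f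
  -- h`. The infimum `N` is the sublinear majorant that encodes both, together with the norm bound.
  let T : G → K → ℝ := fun x p => ‖f‖ * ‖x + p.1.1 + p.1.2‖ - f p.1.2
  let N : G → ℝ := fun x => ⨅ p : K, T x p
  have hbd : ∀ x, BddBelow (Set.range (T x)) := by
    intro x
    refine ⟨-(‖f‖ * ‖x‖), ?_⟩
    rintro _ ⟨⟨⟨k, h⟩, hk, hh⟩, rfl⟩
    -- Monotonicity of the norm is what keeps the infimum finite: it bounds `h` independently of the
    -- choice of `k`.
    have h1 : ‖h‖ ≤ ‖h + k‖ := norm_le_norm_add hh hk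
    have h2 : ‖h + k‖ ≤ ‖x + k + h‖ + ‖x‖ := by
      have : h + k = (x + k + h) - x := by abel
      rw [this]
      exact norm_sub_le _ _
    have h3 := (le_abs_self _).trans (f.abs_apply_le h)
    have h4 := mul_le_mul_of_nonneg_left (h1.trans h2) (norm_nonneg f)
    simp only [T]
    linarith
  have hle : ∀ (x k h : G), 0 ≤ k → 0 ≤ h → N x ≤ ‖f‖ * ‖x + k + h‖ - f h := fun x k h hk hh =>
    ciInf_le (hbd x) ⟨(k, h), hk, hh⟩
  have hhom1 : ∀ c : ℝ, 0 < c → ∀ x, N (c • x) ≤ c * N x := by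
    intro c hc x
    rw [← div_le_iff₀' hc]
    refine le_ciInf fun ⟨⟨k, h⟩, hk, hh⟩ => ?_
    rw [div_le_iff₀' hc]
    refine (hle (c • x) (c • k) (c • h) (smul_nonneg' hc.le hk) (smul_nonneg' hc.le hh)).trans ?_
    rw [← smul_add, ← smul_add, norm_smul, Real.norm_of_nonneg hc.le, map_smul, smul_eq_mul]
    simp only [T]
    exact le_of_eq (by ring)
  have hhom : ∀ c : ℝ, 0 < c → ∀ x, N (c • x) = c * N x := by
    intro c hc x
    refine le_antisymm (hhom1 c hc x) ?_
    have := hhom1 c⁻¹ (inv_pos.2 hc) (c • x)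
    rw [inv_smul_smul₀ hc.ne'] at this
    calc c * N x ≤ c * (c⁻¹ * N (c • x)) := mul_le_mul_of_nonneg_left this hc.le
      _ = N (c • x) := mul_inv_cancel_left₀ hc.ne' _
  have hadd : ∀ x y, N (x + y) ≤ N x + N y := by
    intro x y
    refine le_ciInf_add_ciInf fun ⟨⟨k, h⟩, hk, hh⟩ ⟨⟨k', h'⟩, hk', hh'⟩ => ?_
    refine (hle (x + y) (k + k') (h + h') (add_nonneg' hk hk') (add_nonneg' hh hh')).trans ?_
    have h1 : x + y + (k + k') + (h + h') = (x + k + h) + (y + k' + h') := by abel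
    have h2 := mul_le_mul_of_nonneg_left (norm_add_le (x + k + h) (y + k' + h')) (norm_nonneg f)
    rw [h1, map_add]
    simp only [T]
    linarith
  have hN0 : N 0 = 0 := by
    have := hhom 2 two_pos 0
    rw [smul_zero] at this
    linarith
  obtain ⟨g, -, hg⟩ := exists_extension_of_le_sublinear (⊥ : G →ₗ.[ℝ] ℝ) N hhom hadd (by
    rintro ⟨x, hx⟩
    obtain rfl : x = 0 := (Submodule.mem_bot ℝ).1 hx
    exact ((LinearPMap.map_zero _).trans hN0.symm).le)
  have hgn : ∀ x, g x ≤ ‖f‖ * ‖x‖ := fun x => by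
    have := (hg x).trans (hle x 0 0 le_rfl le_rfl)
    simpa using this
  have hgn' : ∀ x, ‖g x‖ ≤ ‖f‖ * ‖x‖ := fun x => by
    refine abs_le.2 ⟨?_, hgn x⟩
    have := hgn (-x)
    rw [map_neg, norm_neg] at this
    linarith
  let g' : BanachDual G := g.mkContinuous ‖f‖ hgn'
  refine ⟨g', fun x hx => ?_, fun x hx => ?_, g'.norm_le_of_abs_le (norm_nonneg _) hgn'⟩
  -- At `-x` the pair `(x, 0)` gives `g (-x) ≤ 0`; the pair `(0, x)` below gives `g (-x) ≤ -f x`.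
  · have := (hg (-x)).trans (hle (-x) x 0 hx le_rfl)
    simp only [map_neg, neg_add_cancel, add_zero, norm_zero, mul_zero, map_zero, sub_zero] at this
    change 0 ≤ g x
    linarith
  · have := (hg (-x)).trans (hle (-x) 0 x le_rfl hx)
    simp only [map_neg, neg_add_cancel, add_zero, norm_zero, mul_zero, zero_sub] at this
    change f x ≤ g x
    linarith

/-- A positive majorant of `f` plus a positive majorant of `-f` dominates both; it plays the role of
a modulus. -/
theorem BanachDual.exists_absLE (f : BanachDual G) : ∃ g : BanachDual G, AbsLE f g := by
  obtain ⟨g, hg, hfg, -⟩ := f.exists_nonneg_ge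
  obtain ⟨h, hh, hfh, -⟩ := (-f).exists_nonneg_ge
  refine ⟨g + h, fun x hx => ?_, fun x hx => ?_⟩
  all_goals
    have h1 := hg x hx
    have h2 := hfg x hx
    have h3 := hh x hx
    have h4 := hfh x hx
    simp only [BanachDual.zero_apply, BanachDual.neg_apply, BanachDual.add_apply] at *
    linarith

theorem DecreasesToZero.nonneg {Ω V : Type*} [Preorder Ω] [Zero V] [Preorder V] {y : Ω → V}
    (hy : DecreasesToZero y) (α : Ω) : 0 ≤ y α :=
  hy.2.1 ⟨α, rfl⟩

/-- A decreasing net of functionals on a dual space with infimum `0` converges to `0` at the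
positive elements. -/
theorem DecreasesToZero.exists_apply_lt {Ω : Type*} [Preorder Ω]
    [IsDirectedOrder Ω] [Nonempty Ω] {y : Ω → Bidual G} (hy : DecreasesToZero y)
    {φ : BanachDual G} (hφ : 0 ≤ φ) {ε : ℝ} (hε : 0 < ε) : ∃ α, y α φ < ε := by
  have hconv0 : ∀ ψ : BanachDual G, 0 ≤ ψ → ∃ l, Tendsto (fun α => y α ψ) atTop (𝓝 l) :=
    fun ψ hψ => ⟨_, tendsto_atTop_ciInf (fun a b hab => hy.1 hab ψ hψ)
      ⟨0, by rintro _ ⟨α, rfl⟩; exact hy.nonneg α ψ hψ⟩⟩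
  have hconv : ∀ ψ : BanachDual G, ∃ l, Tendsto (fun α => y α ψ) atTop (𝓝 l) := fun ψ => by
    obtain ⟨u, hu, hψu, -⟩ := ψ.exists_nonneg_ge
    obtain ⟨l₁, h₁⟩ := hconv0 u hu
    obtain ⟨l₂, h₂⟩ := hconv0 (u - ψ) fun x hx => by
      have := hψu x hx
      simp only [BanachDual.zero_apply, BanachDual.sub_apply]
      linarith
    refine ⟨l₁ - l₂, (h₁.sub h₂).congr fun α => ?_⟩
    rw [map_sub]
    ring
  choose w hw using hconv
  have hwmono : ∀ ψ u : BanachDual G, ψ ≤ u → w ψ ≤ w u := fun ψ u h => by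
    refine le_of_tendsto_of_tendsto' (hw ψ) (hw u) fun α => ?_
    have := hy.nonneg α (u - ψ) fun x hx => by
      have := h x hx
      simp only [BanachDual.zero_apply, BanachDual.sub_apply]
      linarith
    rw [BanachDual.zero_apply, map_sub] at this
    linarith
  have hwle : ∀ ψ : BanachDual G, 0 ≤ ψ → ∀ α, w ψ ≤ y α ψ := fun ψ hψ α =>
    le_of_tendsto (hw ψ) ((eventually_ge_atTop α).mono fun β hβ => hy.1 hβ ψ hψ)
  let α₀ : Ω := Classical.arbitrary Ω
  -- The pointwise limit is linear, and it is bounded because on the positive cone it lies below any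
  -- single `y α₀`. It is therefore an element of the bidual below the whole net, hence at most the
  -- infimum `0`.
  let W : BanachDual G →ₗ[ℝ] ℝ :=
    { toFun := w
      map_add' := fun ψ u => tendsto_nhds_unique (hw (ψ + u))
        (((hw ψ).add (hw u)).congr fun α => (map_add _ _ _).symm)
      map_smul' := fun c ψ => tendsto_nhds_unique (hw (c • ψ))
        (((hw ψ).const_mul c).congr fun α => (map_smul (y α) c ψ).symm) }
  have hWn : ∀ ψ, W ψ ≤ ‖y α₀‖ * ‖ψ‖ := fun ψ => by
    obtain ⟨u, hu, hψu, hn⟩ := ψ.exists_nonneg_ge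
    calc w ψ ≤ w u := hwmono _ _ hψu
      _ ≤ y α₀ u := hwle u hu α₀
      _ ≤ ‖y α₀‖ * ‖u‖ := (le_abs_self _).trans ((y α₀).abs_apply_le u)
      _ ≤ ‖y α₀‖ * ‖ψ‖ := mul_le_mul_of_nonneg_left hn (norm_nonneg _)
  let w' : Bidual G := W.mkContinuous ‖y α₀‖ fun ψ => abs_le.2 ⟨by
    have := hWn (-ψ)
    rw [map_neg, norm_neg] at this
    linarith, hWn ψ⟩
  have hw' : w' ≤ 0 := hy.2.2 (by rintro _ ⟨α, rfl⟩ ψ hψ; exact hwle ψ hψ α)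
  exact ((hw φ).eventually_lt_const ((hw' φ hφ).trans_lt hε)).exists

end Dual

theorem AbsLE.apply {G : Type*} [NormedAddCommGroup G] [NormedSpace ℝ G] [Preorder G]
    {x y : BanachDual G} (h : AbsLE x y) {φ : G} (hφ : 0 ≤ φ) : |x φ| ≤ y φ :=
  abs_le.2 ⟨h.1 φ hφ, h.2 φ hφ⟩

theorem AbsLE.nonneg {G : Type*} [NormedAddCommGroup G] [NormedSpace ℝ G] [Preorder G]
    {x y : BanachDual G} (h : AbsLE x y) : 0 ≤ y := fun _ hφ =>
  (abs_nonneg _).trans (h.apply hφ)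

/-! ### Order continuity from a monotone modulus -/

section Modulus

variable {V : Type u} {W : Type v} [AddCommGroup V] [Preorder V] [AddCommGroup W] [Preorder W]

/-- A map whose increments at `a` are controlled by a modulus that preserves `y ↓ 0` is order
continuous at `a` in all three senses. -/
theorem orderContinuousAt_of_modulus {f : V → W} {a : V} (D : V → W)
    (hf : ∀ x y, AbsLE (x - a) y → AbsLE (f x - f a) (D y))
    (hD : ∀ (Γ : Type w) [Preorder Γ] [IsDirectedOrder Γ] [Nonempty Γ] (y : Γ → V),
      DecreasesToZero y → DecreasesToZero fun β => D (y β)) :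
    OrderContinuousAt.{w} f a ∧ OneOrderContinuousAt.{w} f a ∧ TwoOrderContinuousAt.{w} f a := by
  refine ⟨?_, ?_, ?_⟩
  · rintro Ω _ _ _ x ⟨y, hy, h⟩
    exact ⟨fun α => D (y α), hD Ω y hy, fun α => hf _ _ (h α)⟩
  · rintro Ω _ _ _ x ⟨y, α₀, hy, h⟩
    exact ⟨fun α => D (y α), α₀, hD Ω y hy, fun α hα => hf _ _ (h α hα)⟩
  · rintro Ω _ _ _ x ⟨Γ, i₁, i₂, i₃, y, hy, h⟩
    refine ⟨Γ, i₁, i₂, i₃, fun β => D (y β), hD Γ y hy, fun β => ?_⟩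
    obtain ⟨α₀, hα₀⟩ := h β
    exact ⟨α₀, fun α hα => hf _ _ (hα₀ α hα)⟩

end Modulus

/-! ### Domination of multilinear operators -/

section Domination

variable {E F : Type*} {m : ℕ}
  [NormedAddCommGroup E] [NormedSpace ℝ E] [Lattice E]
  [NormedAddCommGroup F] [NormedSpace ℝ F]

theorem MultilinearMap.eq_sum_posPart_negPart [IsOrderedAddMonoid E]
    (A : MultilinearMap ℝ (fun _ : Fin m => E) F)
    (x : Fin m → E) :
    A x = ∑ s : Finset (Fin m), (∏ i, if i ∈ s then (1 : ℝ) else -1) •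
      A (s.piecewise (fun i => (x i)⁺) fun i => (x i)⁻) := by
  classical
  have h : A ((fun i => (x i)⁺) + fun i => -(x i)⁻) = ∑ s : Finset (Fin m),
      A (s.piecewise (fun i => (x i)⁺) fun i => -(x i)⁻) := A.map_add_univ _ _
  have hx' : ((fun i => (x i)⁺) + fun i => -(x i)⁻) = x := by
    ext i
    simp [← sub_eq_add_neg, posPart_sub_negPart]
  rw [hx'] at h
  rw [h]
  refine Finset.sum_congr rfl fun s _ => ?_
  rw [← A.map_smul_univ]
  congr 1
  ext i
  by_cases hi : i ∈ s <;> simp [hi]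

theorem MultilinearMap.apply_abs_eq_sum [IsOrderedAddMonoid E]
    (A : MultilinearMap ℝ (fun _ : Fin m => E) F)
    (x : Fin m → E) :
    (A fun i => |x i|) = ∑ s : Finset (Fin m),
      A (s.piecewise (fun i => (x i)⁺) fun i => (x i)⁻) := by
  classical
  rw [← A.map_add_univ]
  congr 1
  ext i
  exact (posPart_add_negPart (x i)).symm

variable [Lattice F] [IsOrderedAddMonoid F]

theorem abs_prod_sign_smul_le (s : Finset (Fin m)) {y : F} (hy : 0 ≤ y) :
    |(∏ i, if i ∈ s then (1 : ℝ) else -1) • y| ≤ y := by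
  have h : (∏ i, if i ∈ s then (1 : ℝ) else -1) = 1 ∨
      (∏ i, if i ∈ s then (1 : ℝ) else -1) = -1 := by
    refine Finset.prod_induction _ (fun c : ℝ => c = 1 ∨ c = -1) ?_ (Or.inl rfl) ?_
    · rintro a b (rfl | rfl) (rfl | rfl) <;> simp
    · intro i _
      split_ifs <;> simp
  rcases h with h | h <;> rw [h] <;> simp [abs_of_nonneg hy]

theorem Finset.abs_sum_le_sum {ι F : Type*} [AddCommGroup F] [Lattice F] [IsOrderedAddMonoid F]
    (s : Finset ι) {f g : ι → F} (h : ∀ i ∈ s, |f i| ≤ g i) : |∑ i ∈ s, f i| ≤ ∑ i ∈ s, g i := by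
  have h1 : ∑ i ∈ s, f i ≤ ∑ i ∈ s, g i :=
    Finset.sum_le_sum fun i hi => (le_abs_self _).trans (h i hi)
  have h2 : -∑ i ∈ s, f i ≤ ∑ i ∈ s, g i := by
    rw [← Finset.sum_neg_distrib]
    exact Finset.sum_le_sum fun i hi => (neg_le_abs _).trans (h i hi)
  exact abs_le'.2 ⟨h1, h2⟩

/-- Expanding `xᵢ = xᵢ⁺ - xᵢ⁻` on the left and `|xᵢ| = xᵢ⁺ + xᵢ⁻` on the right produces the same
positive terms, up to signs on the left. -/
theorem IsPositiveMultilinear.abs_apply_le [IsOrderedAddMonoid E]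
    {A : MultilinearMap ℝ (fun _ : Fin m => E) F}
    (hA : IsPositiveMultilinear A) (x : Fin m → E) : |A x| ≤ A fun i => |x i| := by
  classical
  rw [A.eq_sum_posPart_negPart x, A.apply_abs_eq_sum x]
  refine Finset.abs_sum_le_sum _ fun s _ => abs_prod_sign_smul_le s (hA _ fun i => ?_)
  by_cases hi : i ∈ s
  · simp [hi]
  · simp [hi]

/-- `A` is dominated by `C`: `|A (x₁, …, xₘ)| ≤ C (|x₁|, …, |xₘ|)`. In particular `C` is positive. -/
def IsDominatedBy (A C : ContinuousMultilinearMap ℝ (fun _ : Fin m => E) F) : Prop :=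
  ∀ x : Fin m → E, |A x| ≤ C fun i => |x i|

theorem IsDominatedBy.isPositive [IsOrderedAddMonoid E]
    {A C : ContinuousMultilinearMap ℝ (fun _ : Fin m => E) F}
    (h : IsDominatedBy A C) : IsPositiveMultilinear C.toMultilinearMap := fun x hx => by
  have h1 := (abs_nonneg _).trans (h x)
  simp only [abs_of_nonneg (hx _)] at h1
  exact h1

theorem IsDominatedBy.compBanachDual {A C : ContinuousMultilinearMap ℝ (fun _ : Fin m => E) F}
    (h : IsDominatedBy A C) {φ : BanachDual F} (hφ : 0 ≤ φ) :
    IsDominatedBy (ContinuousLinearMap.compContinuousMultilinearMap (show StrongDual ℝ F from φ) A)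
      (ContinuousLinearMap.compContinuousMultilinearMap (show StrongDual ℝ F from φ) C) := by
  intro x
  refine (BanachDual.abs_apply_le_apply_abs hφ (A x)).trans ?_
  have := hφ _ (sub_nonneg.2 (h x))
  rw [BanachDual.zero_apply, map_sub] at this
  exact sub_nonneg.1 this

end Domination

/-! ### Estimates for Arens extensions of forms -/

section ArensForm

variable {E : Type*} [NormedAddCommGroup E] [NormedSpace ℝ E]

/-- The tuple `(y, v, …, v)`. -/
def headTail {X : Type*} (m : ℕ) (y v : X) : Fin m → X := fun i => if i.val = 0 then y else v

theorem arensForm_succ (n : ℕ) (x : Fin (n + 1) → Bidual E)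
    (A : ContinuousMultilinearMap ℝ (fun _ : Fin (n + 1) => E) ℝ) :
    arensForm (n + 1) x A = arensForm n (fun i => x i.castSucc) (arensStep n (x (Fin.last n)) A) :=
  rfl

theorem arensForm_zero (x : Fin 0 → Bidual E)
    (A : ContinuousMultilinearMap ℝ (fun _ : Fin 0 => E) ℝ) : arensForm 0 x A = A 0 := rfl

theorem arensStep_sub (n : ℕ) (x y : Bidual E)
    (A : ContinuousMultilinearMap ℝ (fun _ : Fin (n + 1) => E) ℝ) :
    arensStep n (x - y) A = arensStep n x A - arensStep n y A := rfl

/-- A family of forms that is stable under partial Arens extension and on which the functionals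
applied to the last two variables may be interchanged. -/
structure IsArensSymmetricFamily
    (𝒞 : ∀ n : ℕ, Set (ContinuousMultilinearMap ℝ (fun _ : Fin n => E) ℝ)) : Prop where
  step_mem : ∀ (n : ℕ) (x : Bidual E), ∀ A ∈ 𝒞 (n + 1), arensStep n x A ∈ 𝒞 n
  step_comm : ∀ (n : ℕ) (x y : Bidual E), ∀ A ∈ 𝒞 (n + 2),
    arensStep n x (arensStep (n + 1) y A) = arensStep n y (arensStep (n + 1) x A)

variable {𝒞 : ∀ n : ℕ, Set (ContinuousMultilinearMap ℝ (fun _ : Fin n => E) ℝ)}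

/-- Successive interchanges of neighbours carry `v` from the last slot, which acts first, to the
first slot, which acts last. -/
theorem IsArensSymmetricFamily.arensForm_arensStep (h𝒞 : IsArensSymmetricFamily 𝒞) {n : ℕ}
    {A : ContinuousMultilinearMap ℝ (fun _ : Fin (n + 1) => E) ℝ} (hA : A ∈ 𝒞 (n + 1))
    (v x : Bidual E) :
    arensForm n (fun _ => x) (arensStep n v A) = arensForm (n + 1) (headTail (n + 1) v x) A := by
  induction n with
  | zero => rfl
  | succ n ih =>
    rw [arensForm_succ, h𝒞.step_comm n x v A hA, ih (h𝒞.step_mem _ _ _ hA)]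
    rfl

variable [Lattice E]

theorem curryRight_nonneg {n : ℕ} {C : ContinuousMultilinearMap ℝ (fun _ : Fin (n + 1) => E) ℝ}
    (hC : IsPositiveMultilinear C.toMultilinearMap) {x : Fin n → E} (hx : ∀ i, 0 ≤ x i) :
    (0 : BanachDual E) ≤ C.curryRight x := fun z hz => by
  refine hC _ fun i => ?_
  refine Fin.lastCases ?_ (fun i => ?_) i
  · simpa using hz
  · simpa using hx i

theorem isPositiveMultilinear_sub_self {n : ℕ}
    (C : ContinuousMultilinearMap ℝ (fun _ : Fin n => E) ℝ) :
    IsPositiveMultilinear (C - C).toMultilinearMap := fun x _ => by simp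

theorem arensStep_mono {n : ℕ} {C C' : ContinuousMultilinearMap ℝ (fun _ : Fin (n + 1) => E) ℝ}
    (hC : IsPositiveMultilinear C.toMultilinearMap)
    (hC' : IsPositiveMultilinear (C' - C).toMultilinearMap) {U U' : Bidual E} (hU : 0 ≤ U)
    (hUU' : U ≤ U') :
    IsPositiveMultilinear (arensStep n U C).toMultilinearMap ∧
      IsPositiveMultilinear (arensStep n U' C' - arensStep n U C).toMultilinearMap := by
  refine ⟨fun x hx => hU _ (curryRight_nonneg hC hx), fun x hx => ?_⟩
  have h1 := hUU' _ (curryRight_nonneg hC hx)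
  have h2 := (hU.trans hUU') _ (curryRight_nonneg hC' hx)
  let φ : BanachDual E := C.curryRight x
  let φ' : BanachDual E := C'.curryRight x
  change 0 ≤ U' φ' - U φ
  change 0 ≤ U' (φ' - φ) at h2
  change U φ ≤ U' φ at h1
  rw [map_sub] at h2
  linarith

theorem arensForm_mono {n : ℕ} {C C' : ContinuousMultilinearMap ℝ (fun _ : Fin n => E) ℝ}
    (hC : IsPositiveMultilinear C.toMultilinearMap)
    (hC' : IsPositiveMultilinear (C' - C).toMultilinearMap) {U U' : Fin n → Bidual E}
    (hU : ∀ i, 0 ≤ U i) (hUU' : ∀ i, U i ≤ U' i) :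
    0 ≤ arensForm n U C ∧ arensForm n U C ≤ arensForm n U' C' := by
  induction n with
  | zero =>
    exact ⟨hC 0 fun i => i.elim0, sub_nonneg.1 (hC' 0 fun i => i.elim0)⟩
  | succ n ih =>
    obtain ⟨h1, h2⟩ := arensStep_mono hC hC' (hU (Fin.last n)) (hUU' (Fin.last n))
    exact ih h1 h2 (fun i => hU i.castSucc) fun i => hUU' i.castSucc

/-- Applying `V` to every variable but the first leaves a positive linear form `ψ`, on which `y` is
evaluated last. This is the weak* continuity of the Arens extension in its first variable; it needs
no symmetry of `C`. -/
theorem exists_arensForm_headTail_eq {n : ℕ}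
    {C : ContinuousMultilinearMap ℝ (fun _ : Fin (n + 1) => E) ℝ}
    (hC : IsPositiveMultilinear C.toMultilinearMap) {V : Bidual E} (hV : 0 ≤ V) :
    ∃ ψ : BanachDual E, 0 ≤ ψ ∧
      ∀ y : Bidual E, arensForm (n + 1) (headTail (n + 1) y V) C = y ψ := by
  induction n with
  | zero =>
    exact ⟨C.curryRight 0, curryRight_nonneg hC fun i => i.elim0, fun y => rfl⟩
  | succ n ih =>
    exact ih (arensStep_mono hC (isPositiveMultilinear_sub_self C) hV le_rfl).1

variable [IsOrderedAddMonoid E]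

/-- With `φ`, `ψ` the last-variable sections of `A` and `C`, both `ψ + φ` and `ψ - φ` are positive.
Half the difference of the values of `x` on them is `x φ`, and half the sum of the values of `U` is
`U ψ`, so no modulus of `φ` or `x` is needed. -/
theorem IsDominatedBy.arensStep {n : ℕ}
    {A C : ContinuousMultilinearMap ℝ (fun _ : Fin (n + 1) => E) ℝ} (h : IsDominatedBy A C)
    {x U : Bidual E} (hx : AbsLE x U) :
    IsDominatedBy (arensStep n x A) (arensStep n U C) := by
  intro z
  let φ : BanachDual E := A.curryRight z
  let ψ : BanachDual E := C.curryRight fun i => |z i|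
  change |x φ| ≤ U ψ
  have key : ∀ e, 0 ≤ e → |φ e| ≤ ψ e := fun e he => by
    have := h (Fin.snoc z e)
    have h2 : (fun i => |(Fin.snoc z e : Fin (n + 1) → E) i|) = Fin.snoc (fun i => |z i|) e := by
      ext i
      refine Fin.lastCases ?_ (fun i => ?_) i
      · simpa using abs_of_nonneg he
      · simp
    rw [h2] at this
    exact this
  have h1 := hx.apply (φ := ψ + φ) fun e he => by
    have := (abs_le.1 (key e he)).1
    simp only [BanachDual.zero_apply, BanachDual.add_apply]
    linarith
  have h2 := hx.apply (φ := ψ - φ) fun e he => by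
    have := (abs_le.1 (key e he)).2
    simp only [BanachDual.zero_apply, BanachDual.sub_apply]
    linarith
  rw [map_add, map_add, abs_le] at h1
  rw [map_sub, map_sub, abs_le] at h2
  exact abs_le.2 ⟨by linarith [h1.1, h2.2], by linarith [h1.2, h2.1]⟩

theorem IsDominatedBy.abs_arensForm_le {n : ℕ}
    {A C : ContinuousMultilinearMap ℝ (fun _ : Fin n => E) ℝ} (h : IsDominatedBy A C)
    {x U : Fin n → Bidual E} (hx : ∀ i, AbsLE (x i) (U i)) :
    |arensForm n x A| ≤ arensForm n U C := by
  induction n with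
  | zero =>
    have := h 0
    rwa [Subsingleton.elim (fun i => |(0 : Fin 0 → E) i|) 0] at this
  | succ n ih => exact ih (h.arensStep (hx (Fin.last n))) fun i => hx i.castSucc

theorem IsArensSymmetricFamily.abs_arensForm_sub_le (h𝒞 : IsArensSymmetricFamily 𝒞) {n : ℕ}
    {A C : ContinuousMultilinearMap ℝ (fun _ : Fin n => E) ℝ} (hA : A ∈ 𝒞 n)
    (h : IsDominatedBy A C) {x a y U : Bidual E} (hx : AbsLE x U) (ha : AbsLE a U)
    (hxa : AbsLE (x - a) y) :
    |arensForm n (fun _ => x) A - arensForm n (fun _ => a) A| ≤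
      n * arensForm n (headTail n y U) C := by
  induction n with
  | zero => simp [arensForm_zero]
  | succ n ih =>
    have h1 : arensForm (n + 1) (fun _ => x) A - arensForm (n + 1) (fun _ => a) A =
        arensForm (n + 1) (headTail (n + 1) (x - a) x) A +
          (arensForm n (fun _ => x) (arensStep n a A) -
            arensForm n (fun _ => a) (arensStep n a A)) := by
      rw [← h𝒞.arensForm_arensStep hA, arensStep_sub, map_sub, arensForm_succ, arensForm_succ]
      ring
    have h2 : |arensForm (n + 1) (headTail (n + 1) (x - a) x) A| ≤
        arensForm (n + 1) (headTail (n + 1) y U) C := h.abs_arensForm_le fun i => by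
      unfold headTail
      split_ifs
      exacts [hxa, hx]
    have h3 := ih (h𝒞.step_mem _ a _ hA) (h.arensStep ha)
    -- For `n = 0` the two forms differ, as `C` receives `U` on one side and `y` on the other, but
    -- the factor `n` vanishes. Otherwise the last entry of `(y, U, …, U)` is `U`.
    have h4 : (n : ℝ) * arensForm n (headTail n y U) (arensStep n U C) =
        n * arensForm (n + 1) (headTail (n + 1) y U) C := by
      cases n with
      | zero => simp
      | succ n => rfl
    rw [h4] at h3
    rw [h1]
    refine (abs_add_le _ _).trans ((add_le_add h2 h3).trans_eq ?_)
    push_cast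
    ring

end ArensForm

/-! ### Uniqueness of the symmetric operator of a polynomial -/

/-- Polarization by differentiation: the `m`-th derivative of `P` at `0` is the sum of the permuted
operators, which symmetry makes `m!` times the operator. -/
theorem IsAssociatedTo.unique {E F : Type*} {m : ℕ}
    [NormedAddCommGroup E] [NormedSpace ℝ E] [NormedAddCommGroup F] [NormedSpace ℝ F]
    {A B : ContinuousMultilinearMap ℝ (fun _ : Fin m => E) F} {P : E → F}
    (hA : IsAssociatedTo A.toMultilinearMap P) (hB : IsAssociatedTo B.toMultilinearMap P) :
    A = B := by
  have key : ∀ {C : ContinuousMultilinearMap ℝ (fun _ : Fin m => E) F},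
      IsAssociatedTo C.toMultilinearMap P → ∀ v : Fin m → E,
        iteratedFDeriv ℝ m P 0 v = (m.factorial : ℝ) • C v := by
    intro C hC v
    have hP : P = fun x => C fun _ => x := funext hC.2
    have hs : ∀ σ : Equiv.Perm (Fin m), (C fun i => v (σ i)) = C v := fun σ => hC.1 σ v
    rw [hP, C.iteratedFDeriv_comp_diagonal, Finset.sum_congr rfl fun σ _ => hs σ]
    simp [Fintype.card_perm, Nat.cast_smul_eq_nsmul]
  ext v
  have h := (key hA v).symm.trans (key hB v)
  exact smul_right_injective F (Nat.cast_ne_zero.2 m.factorial_ne_zero) h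

/-! ### The modulus of continuity of the Arens extension -/

section OrderContinuity

variable {E : Type u} {F : Type v} {m : ℕ}
  [NormedAddCommGroup E] [NormedSpace ℝ E] [Lattice E] [IsOrderedAddMonoid E]
  [IsOrderedModule ℝ E] [HasSolidNorm E]
  [NormedAddCommGroup F] [NormedSpace ℝ F] [Lattice F]

/-- Positivity of `C` makes the net decreasing. For the infimum, freeze the tail at some `U + y β₀`:
beyond `β₀` the values at `φ` are bounded by those of `y` at one positive functional, and these tend
to `0`. -/
theorem decreasesToZero_arensExtension {C : ContinuousMultilinearMap ℝ (fun _ : Fin m => E) F}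
    (hC : IsPositiveMultilinear C.toMultilinearMap) {U : Bidual E} (hU : 0 ≤ U)
    {Γ : Type w} [Preorder Γ] [IsDirectedOrder Γ] [Nonempty Γ] {y : Γ → Bidual E}
    (hy : DecreasesToZero y) :
    DecreasesToZero fun β => (m : ℝ) • arensExtension C (headTail m (y β) (U + y β)) := by
  have hpos : ∀ {φ : BanachDual F}, 0 ≤ φ → IsPositiveMultilinear
      (ContinuousLinearMap.compContinuousMultilinearMap
        (show StrongDual ℝ F from φ) C).toMultilinearMap :=
    fun hφ x hx => hφ _ (hC x hx)
  have hV : ∀ β, 0 ≤ U + y β := fun β ψ hψ => add_nonneg (hU ψ hψ) (hy.nonneg β ψ hψ)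
  have hmono : ∀ {x x' v v' : Bidual E}, 0 ≤ x → x ≤ x' → 0 ≤ v → v ≤ v' →
      ∀ {φ : BanachDual F}, 0 ≤ φ →
      0 ≤ arensExtension C (headTail m x v) φ ∧
      arensExtension C (headTail m x v) φ ≤ arensExtension C (headTail m x' v') φ := by
    intro x x' v v' hx hxx' hv hvv' φ hφ
    refine arensForm_mono (hpos hφ) (isPositiveMultilinear_sub_self _) (fun i => ?_) fun i => ?_
    all_goals
      unfold headTail
      split_ifs
    exacts [hx, hv, hxx', hvv']
  have hUy : ∀ {α β}, α ≤ β → U + y β ≤ U + y α := fun hαβ ψ hψ => by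
    have := hy.1 hαβ ψ hψ
    simp only [BanachDual.add_apply]
    linarith
  refine ⟨fun α β hαβ φ hφ => ?_, ?_, fun w hw φ hφ => ?_⟩
  · exact mul_le_mul_of_nonneg_left
      (hmono (hy.nonneg β) (hy.1 hαβ) (hV β) (hUy hαβ) hφ).2 m.cast_nonneg
  · rintro _ ⟨β, rfl⟩ φ hφ
    exact mul_nonneg m.cast_nonneg (hmono (hy.nonneg β) le_rfl (hV β) le_rfl hφ).1
  · have hw' : ∀ β, w φ ≤ m * arensExtension C (headTail m (y β) (U + y β)) φ :=
      fun β => hw ⟨β, rfl⟩ φ hφ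
    rw [BanachDual.zero_apply]
    let β₀ : Γ := Classical.arbitrary Γ
    -- In degree `0` there is no first slot, but the factor `m` makes the whole net zero.
    cases m with
    | zero => simpa using hw' β₀
    | succ n =>
      obtain ⟨ψ, hψ, h⟩ := exists_arensForm_headTail_eq (hpos hφ) (hV β₀)
      refine le_of_forall_pos_le_add fun ε hε => ?_
      have hn : (0 : ℝ) < (n + 1 : ℕ) := by positivity
      obtain ⟨α, hα⟩ := hy.exists_apply_lt hψ (div_pos hε hn)
      obtain ⟨β, hβα, hβ₀⟩ := exists_ge_ge α β₀
      have h1 : arensExtension C (headTail (n + 1) (y β) (U + y β)) φ ≤ y α ψ :=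
        (hmono (hy.nonneg β) (hy.1 hβα) (hV β) (hUy hβ₀) hφ).2.trans_eq (h (y α))
      calc w φ ≤ (n + 1 : ℕ) * arensExtension C (headTail (n + 1) (y β) (U + y β)) φ := hw' β
        _ ≤ (n + 1 : ℕ) * (ε / (n + 1 : ℕ)) :=
          mul_le_mul_of_nonneg_left (h1.trans hα.le) hn.le
        _ = 0 + ε := by rw [mul_div_cancel₀ _ hn.ne', zero_add]

variable [CompleteSpace E] [IsOrderedAddMonoid F] [HasSolidNorm F]

/-- By uniqueness the symmetric operator of `P₁ - P₂` is the difference of two positive operators;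
their sum dominates it. -/
theorem IsRegularPolynomial.exists_isDominatedBy {P : E → F} (hP : IsRegularPolynomial m P) :
    ∃ C : ContinuousMultilinearMap ℝ (fun _ : Fin m => E) F,
      IsDominatedBy hP.symmetricOperator C := by
  have hS := hP.symmetricOperator_isAssociatedTo
  generalize hP.symmetricOperator = S at hS ⊢
  obtain ⟨P₁, P₂, ⟨A₁, ⟨hs₁, h₁⟩, hA₁⟩, ⟨A₂, ⟨hs₂, h₂⟩, hA₂⟩, h⟩ := hP
  let B₁ : ContinuousMultilinearMap ℝ (fun _ : Fin m => E) F := ⟨A₁, hA₁.continuous⟩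
  let B₂ : ContinuousMultilinearMap ℝ (fun _ : Fin m => E) F := ⟨A₂, hA₂.continuous⟩
  refine ⟨B₁ + B₂, ?_⟩
  rw [hS.unique (B := B₁ - B₂) ⟨fun σ x => ?_, fun x => ?_⟩]
  · intro x
    have h1 := abs_le'.1 (hA₁.abs_apply_le x)
    have h2 := abs_le'.1 (hA₂.abs_apply_le x)
    refine abs_le'.2 ⟨?_, ?_⟩
    · exact (sub_eq_add_neg (A₁ x) (A₂ x)).trans_le (add_le_add h1.1 h2.2)
    · exact (show -(A₁ x - A₂ x) = -A₁ x + A₂ x by abel).trans_le (add_le_add h1.2 h2.1)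
  · change A₁ _ - A₂ _ = A₁ _ - A₂ _
    rw [hs₁ σ x, hs₂ σ x]
  · change P x = A₁ _ - A₂ _
    rw [h, h₁, h₂]

/-- The Arens extension of a regular polynomial is order continuous if the forms `φ ∘ P̌`, `φ ≥ 0`,
belong to a family on which Arens extensions are symmetric. -/
theorem IsArensSymmetricFamily.orderContinuousAt
    {𝒞 : ∀ n : ℕ, Set (ContinuousMultilinearMap ℝ (fun _ : Fin n => E) ℝ)}
    (h𝒞 : IsArensSymmetricFamily 𝒞) {P : E → F} (hP : IsRegularPolynomial m P)
    (hmem : ∀ φ : BanachDual F, 0 ≤ φ → ContinuousLinearMap.compContinuousMultilinearMap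
      (show StrongDual ℝ F from φ) hP.symmetricOperator ∈ 𝒞 m) (x'' : Bidual E) :
    OrderContinuousAt.{w} hP.arensExtension x'' ∧
      OneOrderContinuousAt.{w} hP.arensExtension x'' ∧
      TwoOrderContinuousAt.{w} hP.arensExtension x'' := by
  obtain ⟨C, hC⟩ := hP.exists_isDominatedBy
  obtain ⟨U, hU⟩ := x''.exists_absLE
  refine orderContinuousAt_of_modulus
    (fun y => (m : ℝ) • _root_.arensExtension C (headTail m y (U + y))) (fun x y hxy => ?_)
    fun Γ _ _ _ y hy => decreasesToZero_arensExtension hC.isPositive hU.nonneg hy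
  have hx : AbsLE x (U + y) := by
    refine ⟨fun ψ hψ => ?_, fun ψ hψ => ?_⟩
    all_goals
      have h1 := abs_le.1 (hU.apply hψ)
      have h2 := abs_le.1 (hxy.apply hψ)
      simp only [BanachDual.neg_apply, BanachDual.add_apply, BanachDual.sub_apply] at h2 ⊢
      linarith
  have hx'' : AbsLE x'' (U + y) := by
    refine ⟨fun ψ hψ => ?_, fun ψ hψ => ?_⟩
    all_goals
      have h1 := abs_le.1 (hU.apply hψ)
      have h2 := (abs_nonneg _).trans (hxy.apply hψ)
      simp only [BanachDual.neg_apply, BanachDual.add_apply] at h2 ⊢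
      linarith
  have key : ∀ φ : BanachDual F, 0 ≤ φ → |(hP.arensExtension x - hP.arensExtension x'') φ| ≤
      ((m : ℝ) • _root_.arensExtension C (headTail m y (U + y))) φ := fun φ hφ =>
    h𝒞.abs_arensForm_sub_le (hmem φ hφ) (hC.compBanachDual hφ) hx hx'' hxy
  exact ⟨fun φ hφ => (abs_le.1 (key φ hφ)).1, fun φ hφ => (abs_le.1 (key φ hφ)).2⟩

end OrderContinuity

/-! ### Arens symmetric bilinear forms -/

section ArensSymmetric

variable {E : Type*} [NormedAddCommGroup E] [NormedSpace ℝ E]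

/-- The bilinear form `B` has only one Arens extension: the functionals `x''` and `y''` may be applied
to its variables in either order. Here `B` is assumed to be symmetric. -/
def IsArensSymmetric (B : E →L[ℝ] StrongDual ℝ E) : Prop :=
  ∀ x'' y'' : StrongDual ℝ (StrongDual ℝ E), x'' (y''.comp B) = y'' (x''.comp B)

/-- For `x''` in the unit ball, the pair `(x'' ∘ B, x'' (y'' ∘ B))` is a limit of pairs `(B x, y''
(B x))` with `‖x‖ ≤ 1`, weak* in the first coordinate. Weak compactness makes the graph of `y''`
over the weak closure of these `B x` compact, hence closed, so the limit pair lies on it: `x'' (y''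
∘ B) = y'' (x'' ∘ B)`. -/
theorem IsWeaklyCompactOperator.isArensSymmetric {B : E →L[ℝ] StrongDual ℝ E}
    (hB : IsWeaklyCompactOperator B) (hs : ∀ x y, B x y = B y x) : IsArensSymmetric B := by
  suffices h : ∀ x'' y'' : StrongDual ℝ (StrongDual ℝ E), (∀ f, x'' f ≤ ‖f‖) →
      x'' (y''.comp B) = y'' (x''.comp B) by
    intro x'' y''
    have hc : 0 < ‖x''‖ + 1 := add_pos_of_nonneg_of_pos x''.opNorm_nonneg one_pos
    have h1 := h ((‖x''‖ + 1)⁻¹ • x'') y'' fun f => by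
      have h2 := (le_abs_self _).trans (x''.le_opNorm f)
      change (‖x''‖ + 1)⁻¹ * x'' f ≤ ‖f‖
      rw [inv_mul_le_iff₀ hc]
      linarith [norm_nonneg f]
    rw [ContinuousLinearMap.smul_comp, map_smul] at h1
    exact smul_right_injective ℝ (inv_ne_zero hc.ne') h1
  intro x'' y'' hx''
  let Y := StrongDual ℝ E
  have hlc : LocallyConvexSpace ℝ (WeakDual ℝ E) :=
    inferInstanceAs (LocallyConvexSpace ℝ (WeakBilin (topDualPairing ℝ E)))
  let Φ : WeakSpace ℝ Y →ₗ[ℝ] WeakDual ℝ E × ℝ :=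
    LinearMap.prod
      (StrongDual.toWeakDual.toLinearMap ∘ₗ (toWeakSpace ℝ Y).symm.toLinearMap)
      (y''.toLinearMap ∘ₗ (toWeakSpace ℝ Y).symm.toLinearMap)
  have hev : ∀ f : StrongDual ℝ Y, Continuous fun g : WeakSpace ℝ Y =>
      f ((toWeakSpace ℝ Y).symm g) := fun f =>
    WeakBilin.eval_continuous (topDualPairing ℝ Y).flip f
  have hΦ : Continuous Φ := by
    refine Continuous.prodMk (WeakDual.continuous_of_continuous_eval fun e => ?_) (hev y'')
    exact hev (ContinuousLinearMap.apply ℝ ℝ e : StrongDual ℝ Y)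
  set K := closure (toWeakSpace ℝ Y '' (B '' Metric.closedBall 0 1)) with hK
  have hclosed : IsClosed (Φ '' K) := (IsCompact.image hB hΦ).isClosed
  let p : WeakDual ℝ E × ℝ := (StrongDual.toWeakDual (x''.comp B), x'' (y''.comp B))
  let Ψ : E →ₗ[ℝ] WeakDual ℝ E × ℝ :=
    LinearMap.prod (StrongDual.toWeakDual.toLinearMap ∘ₗ B.toLinearMap)
      (y''.toLinearMap ∘ₗ B.toLinearMap)
  have hΨ : Ψ '' Metric.closedBall 0 1 ⊆ Φ '' K := by
    rintro _ ⟨x, hx, rfl⟩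
    exact ⟨_, subset_closure ⟨_, ⟨x, hx, rfl⟩, rfl⟩, rfl⟩
  have hp : p ∈ Φ '' K := by
    refine closure_minimal hΨ hclosed ?_
    by_contra hp
    obtain ⟨f, s, hfs, hsp⟩ := geometric_hahn_banach_closed_point
      ((convex_closedBall (0 : E) 1).linear_image Ψ).closure isClosed_closure hp
    obtain ⟨e, he⟩ := LinearMap.dualEmbedding_surjective (topDualPairing ℝ E)
      (f.comp (ContinuousLinearMap.inl ℝ (WeakDual ℝ E) ℝ))
    let t : ℝ := f (0, 1)
    have hf : ∀ (g : Y) (r : ℝ), f (StrongDual.toWeakDual g, r) = g e + t * r := fun g r => by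
      have h1 : (StrongDual.toWeakDual g, r) =
        (StrongDual.toWeakDual g, (0 : ℝ)) + r • ((0 : WeakDual ℝ E), (1 : ℝ)) := by simp
      rw [h1, map_add, map_smul, smul_eq_mul, mul_comm]
      congr 1
      exact (DFunLike.congr_fun he (StrongDual.toWeakDual g)).symm
    -- A separating functional has the form `(g, r) ↦ g e + t r`. By symmetry of `B`, its value at
    -- `Ψ x` is `χ x` and its value at `p` is `x'' χ`, so separation would contradict `x'' χ ≤ ‖χ‖ ≤
    -- s`.
    let χ : Y := B e + t • y''.comp B
    have hχ : ∀ x : E, ‖x‖ ≤ 1 → χ x ≤ s := fun x hx => by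
      have := hfs (Ψ x) (subset_closure ⟨x, by simpa using hx, rfl⟩)
      have h2 : Ψ x = (StrongDual.toWeakDual (B x), y'' (B x)) := rfl
      rw [h2, hf, hs] at this
      exact this.le
    have hs0 : 0 ≤ s := by simpa using hχ 0 (by simp)
    have hχn : ‖χ‖ ≤ s := ContinuousLinearMap.opNorm_le_of_unit_norm hs0 fun x hx => by
      have h1 := hχ (-x) (by rw [norm_neg, hx])
      rw [map_neg] at h1
      exact abs_le.2 ⟨by linarith, hχ x hx.le⟩
    have h3 : f p = x'' χ := by
      rw [hf, map_add, map_smul]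
      rfl
    have h4 := (hx'' χ).trans hχn
    linarith
  obtain ⟨g, -, hg⟩ := hp
  have h1 : (toWeakSpace ℝ Y).symm g = x''.comp B := congrArg Prod.fst hg
  have h2 : y'' ((toWeakSpace ℝ Y).symm g) = x'' (y''.comp B) := congrArg Prod.snd hg
  rw [← h2, h1]

/-- By Riesz representation, `x''` and `y''` act on the functionals `⟨k, j ·⟩` through vectors of
`H`; both orders of application give the inner product of these vectors. -/
theorem isArensSymmetric_of_inner {H : Type*} [NormedAddCommGroup H] [InnerProductSpace ℝ H]
    [CompleteSpace H] (j : E →L[ℝ] H) {B : E →L[ℝ] StrongDual ℝ E}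
    (hB : ∀ x y, B x y = inner ℝ (j x) (j y)) : IsArensSymmetric B := by
  have key : ∀ x'' : StrongDual ℝ (StrongDual ℝ E), ∃ h : H, ∀ k : H,
      x'' ((innerSL ℝ k).comp j) = inner ℝ h k := fun x'' => by
    let f : StrongDual ℝ H := x''.comp ((ContinuousLinearMap.compL ℝ E H ℝ).flip j ∘L (innerSL ℝ))
    refine ⟨(InnerProductSpace.toDual ℝ H).symm f, fun k => ?_⟩
    rw [InnerProductSpace.toDual_symm_apply]
    rfl
  intro x'' y''
  obtain ⟨h, hh⟩ := key x''
  obtain ⟨k, hk⟩ := key y''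
  have hBx : ∀ x, B x = (innerSL ℝ (j x)).comp j := fun x => by
    ext y
    exact hB x y
  have h1 : x''.comp B = (innerSL ℝ h).comp j := by
    ext x
    change x'' (B x) = inner ℝ h (j x)
    rw [hBx, hh]
  have h2 : y''.comp B = (innerSL ℝ k).comp j := by
    ext x
    change y'' (B x) = inner ℝ k (j x)
    rw [hBx, hk]
  rw [h1, h2, hh, hk, real_inner_comm]

/-- `D` is a semi-inner product, and the Hausdorff completion of `V` for its seminorm also kills the
null vectors. -/
theorem exists_hilbert_of_posSemidef {V : Type u} [AddCommGroup V] [Module ℝ V]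
    (D : V →ₗ[ℝ] V →ₗ[ℝ] ℝ) (hs : ∀ x y, D x y = D y x) (hpos : ∀ x, 0 ≤ D x x) :
    ∃ (H : Type u) (_ : NormedAddCommGroup H) (_ : InnerProductSpace ℝ H) (_ : CompleteSpace H)
      (j : V →ₗ[ℝ] H), ∀ x y, D x y = inner ℝ (j x) (j y) := by
  let c : PreInnerProductSpace.Core ℝ V :=
    { inner := fun x y => D x y
      conj_inner_symm := fun x y => by simp [hs x y]
      re_inner_nonneg := hpos
      add_left := fun x y z => by simp
      smul_left := fun x y r => by simp }
  let _ : SeminormedAddCommGroup V := InnerProductSpace.Core.toSeminormedAddCommGroup (c := c)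
  let _ : InnerProductSpace ℝ V := InnerProductSpace.ofCore c
  exact ⟨UniformSpace.Completion V, inferInstance, inferInstance, inferInstance,
    (UniformSpace.Completion.toComplL (𝕜 := ℝ) (E := V)).toLinearMap,
    fun x y => (UniformSpace.Completion.inner_coe (𝕜 := ℝ) x y).symm⟩

theorem isArensSymmetric_of_posSemidef {D : E →L[ℝ] StrongDual ℝ E} (hs : ∀ x y, D x y = D y x)
    (hpos : ∀ x, 0 ≤ D x x) : IsArensSymmetric D := by
  let D' : E →ₗ[ℝ] E →ₗ[ℝ] ℝ := (ContinuousLinearMap.coeLM ℝ).comp D.toLinearMap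
  obtain ⟨H, _, _, _, j, hj⟩ := exists_hilbert_of_posSemidef D' hs hpos
  have hjb : ∀ x, ‖j x‖ ≤ Real.sqrt ‖D‖ * ‖x‖ := fun x => by
    refine abs_le_of_sq_le_sq' ?_ (by positivity) |>.2
    rw [← real_inner_self_eq_norm_sq, ← hj, mul_pow, Real.sq_sqrt (norm_nonneg D)]
    calc D x x ≤ ‖D x x‖ := le_abs_self _
      _ ≤ ‖D‖ * ‖x‖ * ‖x‖ := D.le_opNorm₂ x x
      _ = ‖D‖ * ‖x‖ ^ 2 := by ring
  exact isArensSymmetric_of_inner (j.mkContinuous _ hjb) hj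

theorem IsArensSymmetric.of_add_of_sub {B D : E →L[ℝ] StrongDual ℝ E}
    (h₁ : IsArensSymmetric (D + B)) (h₂ : IsArensSymmetric (D - B)) : IsArensSymmetric B := by
  intro x'' y''
  have h3 := h₁ x'' y''
  have h4 := h₂ x'' y''
  rw [ContinuousLinearMap.comp_add, ContinuousLinearMap.comp_add, map_add, map_add] at h3
  rw [ContinuousLinearMap.comp_sub, ContinuousLinearMap.comp_sub, map_sub, map_sub] at h4
  linarith

theorem arensStep_comm {n : ℕ} {A : ContinuousMultilinearMap ℝ (fun _ : Fin (n + 2) => E) ℝ}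
    (h : ∀ x : Fin n → E, IsArensSymmetric (A.curryRight.curryRight x)) (x'' y'' : Bidual E) :
    arensStep n x'' (arensStep (n + 1) y'' A) = arensStep n y'' (arensStep (n + 1) x'' A) := by
  ext x
  exact h x x'' y''

end ArensSymmetric

/-! ### Symmetric forms on symmetrically Arens regular spaces -/

section SymmetricForms

variable {E : Type*} [NormedAddCommGroup E] [NormedSpace ℝ E]

theorem IsSymmetricMultilinear.arensStep {n : ℕ}
    {A : ContinuousMultilinearMap ℝ (fun _ : Fin (n + 1) => E) ℝ}
    (hA : IsSymmetricMultilinear A.toMultilinearMap) (x'' : Bidual E) :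
    IsSymmetricMultilinear (arensStep n x'' A).toMultilinearMap := by
  intro σ x
  have h : A.curryRight (fun i => x (σ i)) = A.curryRight x := by
    ext e
    -- `τ` extends `σ` by fixing the last index, which is the variable that `x''` consumes.
    let τ : Equiv.Perm (Fin (n + 1)) := finSuccEquivLast.permCongr.symm (Equiv.optionCongr σ)
    have := hA τ (Fin.snoc x e)
    have h2 : (fun i => (Fin.snoc x e : Fin (n + 1) → E) (τ i)) = Fin.snoc (fun i => x (σ i)) e := by
      ext i
      refine Fin.lastCases ?_ (fun i => ?_) i <;> simp [τ, Equiv.permCongr_symm]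
    rw [h2] at this
    exact this
  exact congrArg (fun φ : BanachDual E => x'' φ) h

theorem IsSymmetricMultilinear.curryRight_curryRight_comm {n : ℕ}
    {A : ContinuousMultilinearMap ℝ (fun _ : Fin (n + 2) => E) ℝ}
    (hA : IsSymmetricMultilinear A.toMultilinearMap) (x : Fin n → E) (y z : E) :
    A.curryRight.curryRight x y z = A.curryRight.curryRight x z y := by
  have := hA (Equiv.swap (Fin.last (n + 1)) (Fin.last n).castSucc) (Fin.snoc (Fin.snoc x z) y)
  refine Eq.trans ?_ this
  change A _ = A _
  congr 1
  ext i
  refine Fin.lastCases ?_ (fun i => Fin.lastCases ?_ (fun i => ?_) i) i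
  · rw [Equiv.swap_apply_left]; simp
  · rw [Equiv.swap_apply_right]; simp
  · rw [Equiv.swap_apply_of_ne_of_ne (Fin.castSucc_lt_last _).ne
      fun h => (Fin.castSucc_lt_last i).ne (Fin.castSucc_injective _ h)]
    simp

theorem IsSymmetricallyArensRegular.isArensSymmetricFamily (hE : IsSymmetricallyArensRegular E) :
    IsArensSymmetricFamily fun n =>
      {A : ContinuousMultilinearMap ℝ (fun _ : Fin n => E) ℝ |
        IsSymmetricMultilinear A.toMultilinearMap} where
  step_mem _ x'' _ hA := hA.arensStep x''
  step_comm _ x'' y'' _ hA := arensStep_comm (fun x =>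
    (hE _ (hA.curryRight_curryRight_comm x)).isArensSymmetric (hA.curryRight_curryRight_comm x))
    x'' y''

end SymmetricForms

/-! ### The variation of a subadditive function -/

section Variation

variable {E : Type*} [AddCommGroup E] [Lattice E]

/-- `l` is a partition of `x` into finitely many positive elements. -/
def IsPositivePartition (l : Multiset E) (x : E) : Prop := (∀ a ∈ l, 0 ≤ a) ∧ l.sum = x

/-- The supremum of the sums `∑ f (aᵢ)` over the positive partitions `x = ∑ aᵢ`. -/
def variation (f : E → ℝ) (x : E) : ℝ :=
  ⨆ l : {l : Multiset E // IsPositivePartition l x}, (l.1.map f).sum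

theorem isPositivePartition_singleton {x : E} (hx : 0 ≤ x) : IsPositivePartition {x} x :=
  ⟨fun a ha => by rwa [Multiset.mem_singleton.1 ha], Multiset.sum_singleton x⟩

theorem IsPositivePartition.add {l l' : Multiset E} {x x' : E} (h : IsPositivePartition l x)
    (h' : IsPositivePartition l' x') : IsPositivePartition (l + l') (x + x') :=
  ⟨fun a ha => (Multiset.mem_add.1 ha).elim (h.1 a) (h'.1 a), by rw [Multiset.sum_add, h.2, h'.2]⟩

theorem variation_le {f : E → ℝ} {x : E} (hx : 0 ≤ x) {c : ℝ}
    (h : ∀ l, IsPositivePartition l x → (l.map f).sum ≤ c) : variation f x ≤ c :=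
  have : Nonempty {l : Multiset E // IsPositivePartition l x} :=
    ⟨⟨_, isPositivePartition_singleton hx⟩⟩
  ciSup_le fun l => h l.1 l.2

theorem IsPositivePartition.sum_map_le {f : E → ℝ} {g : E →+ ℝ} (hfg : ∀ a, 0 ≤ a → f a ≤ g a)
    {l : Multiset E} {x : E} (hl : IsPositivePartition l x) : (l.map f).sum ≤ g x := by
  rw [← hl.2, map_multiset_sum]
  exact Multiset.sum_map_le_sum_map _ _ fun a ha => hfg a (hl.1 a ha)

theorem IsPositivePartition.sum_map_le_variation {f : E → ℝ} {g : E →+ ℝ}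
    (hfg : ∀ a, 0 ≤ a → f a ≤ g a) {l : Multiset E} {x : E} (hl : IsPositivePartition l x) :
    (l.map f).sum ≤ variation f x :=
  le_ciSup (f := fun l : {l : Multiset E // IsPositivePartition l x} => (l.1.map f).sum)
    ⟨g x, by rintro _ ⟨l, rfl⟩; exact l.2.sum_map_le hfg⟩ ⟨l, hl⟩

theorem le_variation {f : E → ℝ} {g : E →+ ℝ} (hfg : ∀ a, 0 ≤ a → f a ≤ g a) {x : E}
    (hx : 0 ≤ x) : f x ≤ variation f x := by
  simpa using (isPositivePartition_singleton hx).sum_map_le_variation hfg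

theorem variation_le_of_le {f : E → ℝ} {g : E →+ ℝ} (hfg : ∀ a, 0 ≤ a → f a ≤ g a) {x : E}
    (hx : 0 ≤ x) : variation f x ≤ g x :=
  variation_le hx fun _ hl => hl.sum_map_le hfg

theorem variation_congr {f f' : E → ℝ} (h : ∀ a, 0 ≤ a → f a = f' a) (x : E) :
    variation f x = variation f' x := by
  unfold variation
  congr 1
  ext l
  rw [Multiset.map_congr rfl fun a ha => h a (l.2.1 a ha)]

/-- `f` is subadditive on the positive cone. -/
def SubadditiveOnCone (f : E → ℝ) : Prop :=
  f 0 ≤ 0 ∧ ∀ a b, 0 ≤ a → 0 ≤ b → f (a + b) ≤ f a + f b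

theorem SubadditiveOnCone.sum_map_add_le {f : E → ℝ} (hf : SubadditiveOnCone f)
    {p : Multiset (E × E)} (h1 : ∀ a ∈ p.map Prod.fst, 0 ≤ a) (h2 : ∀ a ∈ p.map Prod.snd, 0 ≤ a) :
    ((p.map fun q => q.1 + q.2).map f).sum ≤
      ((p.map Prod.fst).map f).sum + ((p.map Prod.snd).map f).sum := by
  simp only [Multiset.map_map]
  rw [← Multiset.sum_map_add]
  exact Multiset.sum_map_le_sum_map _ _ fun q hq =>
    hf.2 _ _ (h1 _ (Multiset.mem_map_of_mem _ hq)) (h2 _ (Multiset.mem_map_of_mem _ hq))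

variable [IsOrderedAddMonoid E]

theorem IsPositivePartition.le_of_mem {l : Multiset E} {x a : E} (hl : IsPositivePartition l x)
    (ha : a ∈ l) : a ≤ x := by
  rw [← hl.2]
  exact Multiset.single_le_sum hl.1 a ha

theorem variation_eq_zero {f : E → ℝ} {x : E} (hx : 0 ≤ x)
    (h : ∀ a, 0 ≤ a → a ≤ x → f a = 0) : variation f x = 0 := by
  have hz : ∀ l, IsPositivePartition l x → (l.map f).sum = 0 := fun l hl => by
    rw [Multiset.map_congr rfl fun a ha => h a (hl.1 a ha) (hl.le_of_mem ha)]
    simp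
  have : Nonempty {l : Multiset E // IsPositivePartition l x} :=
    ⟨⟨_, isPositivePartition_singleton hx⟩⟩
  unfold variation
  rw [iSup_congr fun l : {l : Multiset E // IsPositivePartition l x} => hz l.1 l.2, ciSup_const]

/-- Riesz decomposition of a partition of a sum. -/
theorem IsPositivePartition.exists_decomposition {l : Multiset E} {x y : E}
    (hl : IsPositivePartition l (x + y)) (hx : 0 ≤ x) (hy : 0 ≤ y) :
    ∃ p : Multiset (E × E), p.map (fun q => q.1 + q.2) = l ∧
      IsPositivePartition (p.map Prod.fst) x ∧ IsPositivePartition (p.map Prod.snd) y := by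
  induction l using Multiset.induction_on generalizing x y with
  | empty =>
    have h0 : 0 = x + y := hl.2
    have hx0 : x = 0 := le_antisymm (by rw [h0]; exact le_add_of_nonneg_right hy) hx
    have hy0 : y = 0 := le_antisymm (by rw [h0]; exact le_add_of_nonneg_left hx) hy
    exact ⟨0, rfl, ⟨by simp, by simp [hx0]⟩, ⟨by simp, by simp [hy0]⟩⟩
  | cons a l ih =>
    have ha : 0 ≤ a := hl.1 a (Multiset.mem_cons_self a l)
    have hsum : a + l.sum = x + y := by rw [← Multiset.sum_cons]; exact hl.2
    have hlpos : ∀ b ∈ l, 0 ≤ b := fun b hb => hl.1 b (Multiset.mem_cons_of_mem hb)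
    have haxy : a ≤ x + y := hl.le_of_mem (Multiset.mem_cons_self a l)
    -- The part `a ⊓ x` of `a` goes to `x`; the remainder fits under `y` because `a ≤ x + y`.
    have h1 : 0 ≤ a ⊓ x := le_inf ha hx
    have h2 : 0 ≤ a - a ⊓ x := sub_nonneg.2 inf_le_left
    have h3 : a - a ⊓ x ≤ y := by
      rw [sub_le_comm]
      exact le_inf (sub_le_self a hy) (sub_le_iff_le_add.2 haxy)
    obtain ⟨p, hp, hp1, hp2⟩ := ih (x := x - a ⊓ x) (y := y - (a - a ⊓ x))
      ⟨hlpos, by rw [eq_sub_of_add_eq' hsum]; abel⟩ (sub_nonneg.2 inf_le_right) (sub_nonneg.2 h3)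
    refine ⟨(a ⊓ x, a - a ⊓ x) ::ₘ p, ?_, ?_, ?_⟩
    · rw [Multiset.map_cons, hp]
      simp
    · have := (isPositivePartition_singleton h1).add hp1
      rwa [add_sub_cancel, Multiset.singleton_add, ← Multiset.map_cons Prod.fst
        (a ⊓ x, a - a ⊓ x) p] at this
    · have := (isPositivePartition_singleton h2).add hp2
      rwa [add_sub_cancel, Multiset.singleton_add, ← Multiset.map_cons Prod.snd
        (a ⊓ x, a - a ⊓ x) p] at this

theorem SubadditiveOnCone.le_sum_map {f : E → ℝ} (hf : SubadditiveOnCone f) {l : Multiset E} {x : E}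
    (hl : IsPositivePartition l x) : f x ≤ (l.map f).sum := by
  rw [← hl.2]
  have hpos := hl.1
  clear hl
  induction l using Multiset.induction_on with
  | empty => simpa using hf.1
  | cons a l ih =>
    have hlpos : ∀ b ∈ l, 0 ≤ b := fun b hb => hpos b (Multiset.mem_cons_of_mem hb)
    rw [Multiset.sum_cons, Multiset.map_cons, Multiset.sum_cons]
    exact (hf.2 _ _ (hpos a (Multiset.mem_cons_self a l)) (Multiset.sum_nonneg hlpos)).trans
      (by have := ih hlpos; linarith)

/-- A partition of `x + y` splits into partitions of `x` and `y`, which by subadditivity does not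
lower the sum; conversely, partitions of `x` and `y` join to one of `x + y`. The additive majorant
`g` keeps the suprema finite. -/
theorem SubadditiveOnCone.variation_add_right {f : E → ℝ} (hf : SubadditiveOnCone f) {g : E →+ ℝ}
    (hfg : ∀ a, 0 ≤ a → f a ≤ g a) {x y : E} (hx : 0 ≤ x) (hy : 0 ≤ y) :
    variation f (x + y) = variation f x + variation f y := by
  refine le_antisymm (variation_le (add_nonneg hx hy) fun l hl => ?_) ?_
  · obtain ⟨p, rfl, hp1, hp2⟩ := hl.exists_decomposition hx hy
    exact (hf.sum_map_add_le hp1.1 hp2.1).trans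
      (add_le_add (hp1.sum_map_le_variation hfg) (hp2.sum_map_le_variation hfg))
  · rw [← le_sub_iff_add_le]
    refine variation_le hx fun l hl => ?_
    rw [le_sub_comm]
    refine variation_le hy fun l' hl' => ?_
    have := (hl.add hl').sum_map_le_variation hfg
    rw [Multiset.map_add, Multiset.sum_add] at this
    linarith

/-- Two partitions have a common refinement. -/
theorem SubadditiveOnCone.exists_common_refinement {f f' : E → ℝ} (hf : SubadditiveOnCone f)
    (hf' : SubadditiveOnCone f') {l l' : Multiset E} {x : E} (hl : IsPositivePartition l x)
    (hl' : IsPositivePartition l' x) :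
    ∃ k, IsPositivePartition k x ∧ (l.map f).sum ≤ (k.map f).sum ∧
      (l'.map f').sum ≤ (k.map f').sum := by
  induction l using Multiset.induction_on generalizing l' x with
  | empty =>
    have hx : x = 0 := hl.2.symm
    subst hx
    refine ⟨0, hl, le_rfl, ?_⟩
    rw [Multiset.map_congr rfl fun a ha =>
      congrArg f' (le_antisymm (hl'.le_of_mem ha) (hl'.1 a ha)), Multiset.map_const',
      Multiset.sum_replicate, Multiset.map_zero, Multiset.sum_zero]
    exact nsmul_nonpos hf'.1 _
  | cons a l ih =>
    have ha : 0 ≤ a := hl.1 a (Multiset.mem_cons_self a l)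
    have hlpos : ∀ b ∈ l, 0 ≤ b := fun b hb => hl.1 b (Multiset.mem_cons_of_mem hb)
    have hsum : a + l.sum = x := by rw [← Multiset.sum_cons]; exact hl.2
    rw [← hsum] at hl'
    obtain ⟨p, rfl, hp1, hp2⟩ := hl'.exists_decomposition ha (Multiset.sum_nonneg hlpos)
    obtain ⟨k, hk, h1, h2⟩ := ih ⟨hlpos, rfl⟩ hp2
    refine ⟨p.map Prod.fst + k, hsum ▸ hp1.add hk, ?_, ?_⟩
    · rw [Multiset.map_cons, Multiset.sum_cons, Multiset.map_add, Multiset.sum_add]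
      exact add_le_add (hf.le_sum_map hp1) h1
    · refine (hf'.sum_map_add_le hp1.1 hp2.1).trans ?_
      rw [Multiset.map_add, Multiset.sum_add]
      linarith

/-- Subadditivity makes the sums grow under refinement, so a common refinement serves both suprema
at once. -/
theorem SubadditiveOnCone.variation_add_left {f f' : E → ℝ} (hf : SubadditiveOnCone f)
    (hf' : SubadditiveOnCone f') {g g' : E →+ ℝ} (hfg : ∀ a, 0 ≤ a → f a ≤ g a)
    (hfg' : ∀ a, 0 ≤ a → f' a ≤ g' a) {x : E} (hx : 0 ≤ x) :
    variation (fun a => f a + f' a) x = variation f x + variation f' x := by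
  refine le_antisymm (variation_le hx fun l hl => ?_) ?_
  · rw [Multiset.sum_map_add]
    exact add_le_add (hl.sum_map_le_variation hfg) (hl.sum_map_le_variation hfg')
  · rw [← le_sub_iff_add_le]
    refine variation_le hx fun l hl => ?_
    rw [le_sub_comm]
    refine variation_le hx fun l' hl' => ?_
    obtain ⟨k, hk, h1, h2⟩ := hf.exists_common_refinement hf' hl hl'
    have := hk.sum_map_le_variation (f := fun a => f a + f' a) (g := g + g')
      fun a ha => add_le_add (hfg a ha) (hfg' a ha)
    rw [Multiset.sum_map_add] at this
    linarith

/-- The additive extension to the whole space of a function that is additive on the cone. -/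
def coneExtension (h : E → ℝ) (hadd : ∀ a b, 0 ≤ a → 0 ≤ b → h (a + b) = h a + h b) : E →+ ℝ :=
  AddMonoidHom.mk' (fun x => h x⁺ - h x⁻) fun x y => by
    have h1 : (x + y)⁺ + (x⁻ + y⁻) = (x + y)⁻ + (x⁺ + y⁺) := by
      rw [sub_eq_iff_eq_add.1 (posPart_sub_negPart x), sub_eq_iff_eq_add.1 (posPart_sub_negPart y),
        sub_eq_iff_eq_add.1 (posPart_sub_negPart (x + y))]
      abel
    have h2 := congrArg h h1
    rw [hadd _ _ (posPart_nonneg _) (add_nonneg (negPart_nonneg _) (negPart_nonneg _)),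
      hadd _ _ (negPart_nonneg _) (negPart_nonneg _),
      hadd _ _ (negPart_nonneg _) (add_nonneg (posPart_nonneg _) (posPart_nonneg _)),
      hadd _ _ (posPart_nonneg _) (posPart_nonneg _)] at h2
    linarith

end Variation

/-! ### The modulus of an orthosymmetric bilinear form -/

section Modulus

variable {E : Type*} [NormedAddCommGroup E] [Lattice E] [IsOrderedAddMonoid E] [HasSolidNorm E]

theorem norm_posPart_le (x : E) : ‖x⁺‖ ≤ ‖x‖ := norm_le_norm_of_abs_le_abs (by
  rw [abs_of_nonneg (posPart_nonneg x), ← posPart_add_negPart x]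
  exact le_add_of_nonneg_right (negPart_nonneg x))

theorem norm_negPart_le (x : E) : ‖x⁻‖ ≤ ‖x‖ := norm_le_norm_of_abs_le_abs (by
  rw [abs_of_nonneg (negPart_nonneg x), ← posPart_add_negPart x]
  exact le_add_of_nonneg_left (posPart_nonneg x))

variable [NormedSpace ℝ E]

/-- A bounded function of two variables that is additive on the positive cone in each variable
extends to a continuous bilinear form. -/
theorem exists_bilinear_extension {S : E → E → ℝ} {K : ℝ} (hK : 0 ≤ K)
    (hS : ∀ x y, 0 ≤ x → 0 ≤ y → |S x y| ≤ K * ‖x‖ * ‖y‖)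
    (hl : ∀ x x' y, 0 ≤ x → 0 ≤ x' → 0 ≤ y → S (x + x') y = S x y + S x' y)
    (hr : ∀ x y y', 0 ≤ x → 0 ≤ y → 0 ≤ y' → S x (y + y') = S x y + S x y') :
    ∃ D : E →L[ℝ] StrongDual ℝ E, ∀ x y, 0 ≤ x → 0 ≤ y → D x y = S x y := by
  have hS0 : ∀ x, 0 ≤ x → S x 0 = 0 := fun x hx => by
    have := hr x 0 0 hx le_rfl le_rfl
    rw [add_zero] at this
    linarith
  have hS0' : ∀ y, 0 ≤ y → S 0 y = 0 := fun y hy => by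
    have := hl 0 0 y le_rfl le_rfl hy
    rw [add_zero] at this
    linarith
  have hbd : ∀ x : {x : E // 0 ≤ x}, ∀ y,
      ‖coneExtension (S x) (fun a b ha hb => hr x a b x.2 ha hb) y‖ ≤ 2 * K * ‖x.1‖ * ‖y‖ := by
    rintro ⟨x, hx⟩ y
    have hc : 0 ≤ K * ‖x‖ := mul_nonneg hK (norm_nonneg x)
    have h1 := (hS x y⁺ hx (posPart_nonneg y)).trans
      (mul_le_mul_of_nonneg_left (norm_posPart_le y) hc)
    have h2 := (hS x y⁻ hx (negPart_nonneg y)).trans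
      (mul_le_mul_of_nonneg_left (norm_negPart_le y) hc)
    calc |S x y⁺ - S x y⁻| ≤ |S x y⁺| + |S x y⁻| := abs_sub _ _
      _ ≤ 2 * K * ‖x‖ * ‖y‖ := by linarith
  let T : {x : E // 0 ≤ x} → StrongDual ℝ E := fun x =>
    (coneExtension (S x) fun a b ha hb => hr x a b x.2 ha hb).toRealLinearMap
      (AddMonoidHomClass.continuous_of_bound _ _ (hbd x))
  have hTapp : ∀ x y, T x y = S x y⁺ - S x y⁻ := fun x y => rfl
  have hTn : ∀ x, ‖T x‖ ≤ 2 * K * ‖x.1‖ := fun x =>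
    ContinuousLinearMap.opNorm_le_bound _ (by positivity) (hbd x)
  let R : E →+ StrongDual ℝ E := AddMonoidHom.mk'
    (fun x => T ⟨x⁺, posPart_nonneg x⟩ - T ⟨x⁻, negPart_nonneg x⟩) fun x x' => by
      ext y
      have hadd : ∀ a b, 0 ≤ a → 0 ≤ b →
          S (a + b) y⁺ - S (a + b) y⁻ = (S a y⁺ - S a y⁻) + (S b y⁺ - S b y⁻) := fun a b ha hb => by
        rw [hl _ _ _ ha hb (posPart_nonneg y), hl _ _ _ ha hb (negPart_nonneg y)]
        ring
      exact (coneExtension (fun x => S x y⁺ - S x y⁻) hadd).map_add x x'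
  have hR : ∀ x, ‖R x‖ ≤ 4 * K * ‖x‖ := fun x => by
    have hc : 0 ≤ 2 * K := by positivity
    have h1 := (hTn ⟨x⁺, posPart_nonneg x⟩).trans
      (mul_le_mul_of_nonneg_left (norm_posPart_le x) hc)
    have h2 := (hTn ⟨x⁻, negPart_nonneg x⟩).trans
      (mul_le_mul_of_nonneg_left (norm_negPart_le x) hc)
    exact (norm_sub_le _ _).trans (by linarith)
  refine ⟨R.toRealLinearMap (AddMonoidHomClass.continuous_of_bound _ _ hR), fun x y hx hy => ?_⟩
  change (S x⁺ y⁺ - S x⁺ y⁻) - (S x⁻ y⁺ - S x⁻ y⁻) = S x y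
  rw [posPart_of_nonneg hx, posPart_of_nonneg hy, negPart_of_nonneg hx, negPart_of_nonneg hy,
    hS0 x hx, hS0 0 le_rfl, hS0' y hy]
  ring

/-- The form is an iterated variation of `|B|`, first in the second variable and then in the first.
It vanishes on disjoint `x`, `y` because all pieces of `x` are disjoint from all pieces of `y`. -/
theorem exists_orthosymmetric_modulus {B C : E →L[ℝ] StrongDual ℝ E}
    (hBC : ∀ x y, 0 ≤ x → 0 ≤ y → |B x y| ≤ C x y)
    (hB : ∀ x y, 0 ≤ x → 0 ≤ y → x ⊓ y = 0 → B x y = 0) :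
    ∃ D : E →L[ℝ] StrongDual ℝ E, (∀ x y, 0 ≤ x → 0 ≤ y → |B x y| ≤ D x y) ∧
      ∀ x y, 0 ≤ x → 0 ≤ y → x ⊓ y = 0 → D x y = 0 := by
  let M : E → E → ℝ := fun a => variation fun b => |B a b|
  let S : E → E → ℝ := fun x y => variation (fun a => M a y) x
  have hC : ∀ a, 0 ≤ a → ∀ b, 0 ≤ b → |B a b| ≤ (C a : E →+ ℝ) b := fun a ha b hb => hBC a b ha hb
  have hMC : ∀ y, 0 ≤ y → ∀ a, 0 ≤ a → M a y ≤ (C.flip y : E →+ ℝ) a := fun y hy a ha =>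
    variation_le_of_le (hC a ha) hy
  have hsub : ∀ a, SubadditiveOnCone fun b => |B a b| := fun a =>
    ⟨by simp, fun b b' _ _ => by
      simpa only [map_add] using abs_add_le (B a b) (B a b')⟩
  have hMsub : ∀ y, 0 ≤ y → SubadditiveOnCone fun a => M a y := fun y hy => by
    refine ⟨(variation_eq_zero hy fun b _ _ => by simp).le, fun a a' ha ha' => ?_⟩
    refine variation_le hy fun l hl => ?_
    refine le_trans ?_ (add_le_add (hl.sum_map_le_variation (hC a ha))
      (hl.sum_map_le_variation (hC a' ha')))
    rw [← Multiset.sum_map_add]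
    refine Multiset.sum_map_le_sum_map _ _ fun b _ => ?_
    rw [map_add]
    exact abs_add_le _ _
  have hBM : ∀ a b, 0 ≤ a → 0 ≤ b → |B a b| ≤ M a b := fun a b ha hb => le_variation (hC a ha) hb
  have hBS : ∀ x y, 0 ≤ x → 0 ≤ y → |B x y| ≤ S x y := fun x y hx hy =>
    (hBM x y hx hy).trans (le_variation (hMC y hy) hx)
  obtain ⟨D, hD⟩ := exists_bilinear_extension (S := S) (norm_nonneg C) (fun x y hx hy => by
      rw [abs_of_nonneg ((abs_nonneg _).trans (hBS x y hx hy))]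
      exact (variation_le_of_le (hMC y hy) hx).trans
        ((le_abs_self _).trans (C.le_opNorm₂ x y)))
    (fun x x' y hx hx' hy => (hMsub y hy).variation_add_right (hMC y hy) hx hx')
    -- Additivity in `y` holds for each inner variation `M a`; it passes through the outer supremum
    -- because the functions `M · y` and `M · y'` are subadditive.
    (fun x y y' hx hy hy' => by
      refine Eq.trans ?_ ((hMsub y hy).variation_add_left (hMsub y' hy') (hMC y hy) (hMC y' hy') hx)
      exact variation_congr (fun a ha => (hsub a).variation_add_right (hC a ha) hy hy') x)
  refine ⟨D, fun x y hx hy => (hBS x y hx hy).trans_eq (hD x y hx hy).symm,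
    fun x y hx hy hxy => ?_⟩
  rw [hD x y hx hy]
  refine variation_eq_zero hx fun a ha hax => variation_eq_zero hy fun b hb hby => ?_
  rw [hB a b ha hb (le_antisymm ((inf_le_inf hax hby).trans_eq hxy) (le_inf ha hb)), abs_zero]

/-- Symmetric orthosymmetric bilinear forms that are dominated by a positive form are Arens
symmetric: they are differences of positive semidefinite ones. -/
theorem isArensSymmetric_of_orthosymmetric {B C : E →L[ℝ] StrongDual ℝ E}
    (hBC : ∀ x y, 0 ≤ x → 0 ≤ y → |B x y| ≤ C x y) (hs : ∀ x y, B x y = B y x)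
    (hB : ∀ x y, 0 ≤ x → 0 ≤ y → x ⊓ y = 0 → B x y = 0) : IsArensSymmetric B := by
  obtain ⟨D, hBD, hD⟩ := exists_orthosymmetric_modulus hBC hB
  have hD' : ∀ x y, 0 ≤ x → 0 ≤ y → |B x y| ≤ (D + D.flip) x y := fun x y hx hy => by
    have h1 := hBD x y hx hy
    have h2 := (abs_nonneg _).trans (hBD y x hy hx)
    change |B x y| ≤ D x y + D y x
    linarith
  -- The cross terms vanish by orthosymmetry, so `G x x = G x⁺ x⁺ + G x⁻ x⁻`. This is applied to `G
  -- = D + D.flip ± B`, which is symmetric.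
  have key : ∀ G : E →L[ℝ] StrongDual ℝ E, (∀ x, 0 ≤ x → 0 ≤ G x x) →
      (∀ x y, 0 ≤ x → 0 ≤ y → x ⊓ y = 0 → G x y = 0) → ∀ x, 0 ≤ G x x := by
    intro G hG hG0 x
    have hxn : x⁺ ⊓ x⁻ = 0 := posPart_inf_negPart_eq_zero x
    have h1 := hG _ (posPart_nonneg x)
    have h2 := hG _ (negPart_nonneg x)
    have h3 := hG0 _ _ (posPart_nonneg x) (negPart_nonneg x) hxn
    have h4 := hG0 _ _ (negPart_nonneg x) (posPart_nonneg x) (by rwa [inf_comm])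
    have h5 : G x x = G (x⁺ - x⁻) (x⁺ - x⁻) := by rw [posPart_sub_negPart]
    rw [h5]
    simp only [map_sub, _root_.sub_apply]
    linarith
  have hDB0 : ∀ x y, 0 ≤ x → 0 ≤ y → x ⊓ y = 0 → (D + D.flip) x y = 0 := fun x y hx hy hxy => by
    change D x y + D y x = 0
    rw [hD x y hx hy hxy, hD y x hy hx (by rwa [inf_comm]), add_zero]
  have hDs : ∀ x y, (D + D.flip) x y = (D + D.flip) y x := fun x y => add_comm _ _
  refine IsArensSymmetric.of_add_of_sub (D := D + D.flip)
    (isArensSymmetric_of_posSemidef (fun x y => ?_) (key _ (fun x hx => ?_) fun x y hx hy hxy => ?_))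
    (isArensSymmetric_of_posSemidef (fun x y => ?_) (key _ (fun x hx => ?_) fun x y hx hy hxy => ?_))
  · exact congrArg₂ (· + ·) (hDs x y) (hs x y)
  · have := (abs_le.1 (hD' x x hx hx)).1
    change 0 ≤ (D + D.flip) x x + B x x
    linarith
  · exact (congrArg₂ (· + ·) (hDB0 x y hx hy hxy) (hB x y hx hy hxy)).trans (add_zero 0)
  · exact congrArg₂ (· - ·) (hDs x y) (hs x y)
  · have := (abs_le.1 (hD' x x hx hx)).2
    change 0 ≤ (D + D.flip) x x - B x x
    linarith
  · exact (congrArg₂ (· - ·) (hDB0 x y hx hy hxy) (hB x y hx hy hxy)).trans (sub_zero 0)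

end Modulus

/-! ### Orthogonally additive polynomials -/

section Disjoint

theorem abs_real_smul_le {E : Type*} [AddCommGroup E] [Lattice E]
    [Module ℝ E] [IsOrderedModule ℝ E] (c : ℝ) (x : E) : |c • x| ≤ |c| • |x| := by
  rcases le_total 0 c with hc | hc
  · rw [abs_of_nonneg hc]
    refine abs_le'.2 ⟨smul_le_smul_of_nonneg_left (le_abs_self x) hc, ?_⟩
    rw [← smul_neg]
    exact smul_le_smul_of_nonneg_left (neg_le_abs x) hc
  · rw [abs_of_nonpos hc]
    have hc' : 0 ≤ -c := neg_nonneg.2 hc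
    refine abs_le'.2 ⟨?_, ?_⟩
    · rw [← neg_smul_neg]
      exact smul_le_smul_of_nonneg_left (neg_le_abs x) hc'
    · rw [← neg_smul]
      exact smul_le_smul_of_nonneg_left (le_abs_self x) hc'

variable {E : Type*} [AddCommGroup E] [Lattice E] [IsOrderedAddMonoid E]

theorem inf_add_le_of_nonneg {a b c : E} (ha : 0 ≤ a) (hb : 0 ≤ b) (hc : 0 ≤ c) :
    a ⊓ (b + c) ≤ a ⊓ b + a ⊓ c := by
  rw [add_inf, inf_add, inf_add]
  refine le_inf (le_inf ?_ ?_) (le_inf ?_ inf_le_right)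
  · exact inf_le_left.trans (le_add_of_nonneg_right ha)
  · exact inf_le_left.trans (le_add_of_nonneg_left hb)
  · exact inf_le_left.trans (le_add_of_nonneg_right hc)

theorem abs_inf_abs_eq_zero_of_le {a b a' b' : E} (h : |a| ⊓ |b| = 0) (ha : |a'| ≤ |a|)
    (hb : |b'| ≤ |b|) : |a'| ⊓ |b'| = 0 :=
  le_antisymm ((inf_le_inf ha hb).trans_eq h) (le_inf (abs_nonneg _) (abs_nonneg _))

variable [Module ℝ E] [IsOrderedModule ℝ E]

/-- The disjoint complement of a vector of a Riesz space. -/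
def disjointComplement (a : E) : Submodule ℝ E where
  carrier := {b | |a| ⊓ |b| = 0}
  zero_mem' := by simp
  add_mem' {b c} hb hc := by
    refine le_antisymm ?_ (le_inf (abs_nonneg _) (abs_nonneg _))
    calc |a| ⊓ |b + c| ≤ |a| ⊓ (|b| + |c|) := inf_le_inf_left _ (by
          refine abs_le'.2 ⟨add_le_add (le_abs_self b) (le_abs_self c), ?_⟩
          rw [neg_add]
          exact add_le_add (neg_le_abs b) (neg_le_abs c))
      _ ≤ |a| ⊓ |b| + |a| ⊓ |c| := inf_add_le_of_nonneg (abs_nonneg _) (abs_nonneg _) (abs_nonneg _)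
      _ = 0 := by rw [show |a| ⊓ |b| = 0 from hb, show |a| ⊓ |c| = 0 from hc, add_zero]
  smul_mem' c b hb := by
    have hn : ∀ n : ℕ, |a| ⊓ n • |b| = 0 := fun n => by
      induction n with
      | zero => simp
      | succ n ih =>
        refine le_antisymm ?_ (le_inf (abs_nonneg _) (nsmul_nonneg (abs_nonneg _) _))
        rw [succ_nsmul]
        refine (inf_add_le_of_nonneg (abs_nonneg _) (nsmul_nonneg (abs_nonneg _) _)
          (abs_nonneg _)).trans_eq ?_
        rw [ih, show |a| ⊓ |b| = 0 from hb, add_zero]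
    obtain ⟨n, hcn⟩ := exists_nat_ge |c|
    refine le_antisymm ?_ (le_inf (abs_nonneg _) (abs_nonneg _))
    rw [← hn n]
    refine inf_le_inf_left _ ((abs_real_smul_le c b).trans ?_)
    rw [← Nat.cast_smul_eq_nsmul ℝ]
    exact smul_le_smul_of_nonneg_right hcn (abs_nonneg b)

theorem mem_disjointComplement {a b : E} : b ∈ disjointComplement a ↔ |a| ⊓ |b| = 0 := Iff.rfl

theorem mem_disjointComplement_comm {a b : E} :
    b ∈ disjointComplement a ↔ a ∈ disjointComplement b := by
  rw [mem_disjointComplement, mem_disjointComplement, inf_comm]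

theorem mem_disjointComplement_of_le {a b c : E} (hb : b ∈ disjointComplement a) (h : |c| ≤ |b|) :
    c ∈ disjointComplement a :=
  abs_inf_abs_eq_zero_of_le hb le_rfl h

theorem mem_disjointComplement_of_nonneg_le {a b c : E} (hb : b ∈ disjointComplement a) (hc : 0 ≤ c)
    (h : c ≤ b) : c ∈ disjointComplement a :=
  mem_disjointComplement_of_le hb (by rwa [abs_of_nonneg hc, abs_of_nonneg (hc.trans h)])

end Disjoint

/-! ### From orthogonal additivity to orthosymmetry -/

section OrthogonallyAdditive

variable {E F : Type*} {m : ℕ}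
  [NormedAddCommGroup E] [NormedSpace ℝ E] [Lattice E] [IsOrderedAddMonoid E]
  [IsOrderedModule ℝ E]
  [NormedAddCommGroup F] [NormedSpace ℝ F]
  {A : ContinuousMultilinearMap ℝ (fun _ : Fin m => E) F} {P : E → F}

/-- On `ℝ^m`, the polynomial `t ↦ P (∑ tᵢ xᵢ)` is the sum of its parts over `S` and `Sᶜ`. Uniqueness
of the symmetric operators gives the same identity for them; evaluated at the coordinate vectors it
expresses `A x` as a sum of two values, each with a zero entry since `S` and `Sᶜ` are nonempty. -/
theorem IsOrthogonallyAdditive.apply_eq_zero_of_forall_mem (hP : IsOrthogonallyAdditive P)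
    (hA : IsAssociatedTo A.toMultilinearMap P) (S : Finset (Fin m)) {i j : Fin m} (hi : i ∈ S)
    (hj : j ∉ S) {x : Fin m → E} (hx : ∀ i ∈ S, ∀ j ∉ S, x j ∈ disjointComplement (x i)) :
    A x = 0 := by
  classical
  let L : Finset (Fin m) → (Fin m → ℝ) →L[ℝ] E := fun T =>
    ∑ i ∈ T, (ContinuousLinearMap.proj (R := ℝ) (φ := fun _ : Fin m => ℝ) i).smulRight (x i)
  have hL : ∀ T t, L T t = ∑ i ∈ T, t i • x i := fun T t => by simp [L]
  have hLS : ∀ t, L Finset.univ t = L S t + L Sᶜ t := fun t => by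
    rw [hL, hL, hL, Finset.sum_add_sum_compl]
  have hdisj : ∀ t, |L S t| ⊓ |L Sᶜ t| = 0 := fun t => by
    rw [← mem_disjointComplement, hL, hL]
    refine Submodule.sum_mem _ fun j hj => Submodule.smul_mem _ _ ?_
    rw [mem_disjointComplement_comm]
    refine Submodule.sum_mem _ fun i hi => Submodule.smul_mem _ _ ?_
    rw [mem_disjointComplement_comm]
    exact hx i hi j (Finset.mem_compl.1 hj)
  let B : Finset (Fin m) → ContinuousMultilinearMap ℝ (fun _ : Fin m => Fin m → ℝ) F := fun T =>
    A.compContinuousLinearMap fun _ => L T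
  have hB : ∀ T, IsSymmetricMultilinear (B T).toMultilinearMap := fun T σ t =>
    hA.1 σ fun k => L T (t k)
  have h1 : IsAssociatedTo (B Finset.univ).toMultilinearMap fun t => P (L Finset.univ t) :=
    ⟨hB _, fun t => hA.2 _⟩
  have h2 : IsAssociatedTo (B S + B Sᶜ).toMultilinearMap fun t => P (L Finset.univ t) := by
    refine ⟨fun σ t => congrArg₂ (· + ·) (hB S σ t) (hB Sᶜ σ t), fun t => ?_⟩
    refine (congrArg P (hLS t)).trans ((hP _ _ (hdisj t)).trans ?_)
    rw [hA.2, hA.2]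
    rfl
  have h3 := DFunLike.congr_fun (h1.unique h2) fun k => Pi.single k 1
  have h4 : ∀ T k, L T (Pi.single k 1) = if k ∈ T then x k else 0 := fun T k => by
    rw [hL, Finset.sum_congr rfl fun i _ => by rw [Pi.single_apply, ite_smul, one_smul, zero_smul]]
    rw [Finset.sum_ite_eq' T k]
  change A (fun k => L Finset.univ (Pi.single k 1)) =
    A (fun k => L S (Pi.single k 1)) + A (fun k => L Sᶜ (Pi.single k 1)) at h3
  rw [A.map_coord_zero (m := fun k => L S (Pi.single k 1)) j (by rw [h4, if_neg hj]),
    A.map_coord_zero (m := fun k => L Sᶜ (Pi.single k 1)) i (by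
      rw [h4, if_neg fun h => Finset.mem_compl.1 h hi]), add_zero] at h3
  simpa [h4] using h3

variable [HasSolidNorm E]

/-- Induction on the number of indices outside both groups. After a small perturbation of the
entries in `S`, an unassigned entry splits into a part that may join `S` and a part that may join
`T`; continuity of `A` removes the perturbation. -/
theorem IsOrthogonallyAdditive.apply_eq_zero_of_disjoint_groups (hP : IsOrthogonallyAdditive P)
    (hA : IsAssociatedTo A.toMultilinearMap P) (k : ℕ) (S T : Finset (Fin m)) (hST : Disjoint S T)
    (hk : ((S ∪ T)ᶜ).card = k) {i j : Fin m} (hi : i ∈ S) (hj : j ∈ T) {x : Fin m → E}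
    (hx0 : ∀ i, 0 ≤ x i) (hx : ∀ i ∈ S, ∀ j ∈ T, x j ∈ disjointComplement (x i)) :
    A x = 0 := by
  classical
  induction k generalizing S T x with
  | zero =>
    have huniv : S ∪ T = Finset.univ := by
      rwa [Finset.card_eq_zero, Finset.compl_eq_empty_iff] at hk
    refine hP.apply_eq_zero_of_forall_mem hA S hi
      (fun h => Finset.disjoint_left.1 hST h hj) fun i hi j hj => hx i hi j ?_
    have := Finset.mem_univ j
    rw [← huniv, Finset.mem_union] at this
    exact this.resolve_left hj
  | succ k ih =>
    obtain ⟨r, hr⟩ : ((S ∪ T)ᶜ).Nonempty := Finset.card_pos.1 (by omega)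
    have hrS : r ∉ S := fun h => Finset.mem_compl.1 hr (Finset.mem_union_left _ h)
    have hrT : r ∉ T := fun h => Finset.mem_compl.1 hr (Finset.mem_union_right _ h)
    have hcard : ((insert r (S ∪ T))ᶜ).card = k := by
      rw [Finset.compl_insert, Finset.card_erase_of_mem hr, hk]
      rfl
    set z := x r with hz
    let s := ∑ i ∈ S, x i
    have hs : 0 ≤ s := Finset.sum_nonneg fun i _ => hx0 i
    let y : ℕ → Fin m → E := fun n i =>
      if i ∈ S then (x i - ((1 : ℝ) / (n + 1)) • z)⁺ else x i
    have hyS : ∀ n, ∀ i ∈ S, y n i = (x i - ((1 : ℝ) / (n + 1)) • z)⁺ := fun n i hi => if_pos hi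
    have hyS' : ∀ n, ∀ i ∉ S, y n i = x i := fun n i hi => if_neg hi
    have hy0 : ∀ n i, 0 ≤ y n i := fun n i => by
      by_cases h : i ∈ S
      · rw [hyS n i h]
        exact posPart_nonneg _
      · rw [hyS' n i h]
        exact hx0 i
    have hcz : ∀ n : ℕ, 0 ≤ ((1 : ℝ) / (n + 1)) • z := fun n =>
      smul_nonneg (by positivity) (hx0 r)
    have hyle : ∀ n i, y n i ≤ x i := fun n i => by
      by_cases h : i ∈ S
      · rw [hyS n i h]
        exact sup_le (sub_le_self _ (hcz n)) (hx0 i)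
      · rw [hyS' n i h]
    have hy : ∀ n, ∀ i ∈ S, ∀ j ∈ T, y n j ∈ disjointComplement (y n i) := fun n i hi j hj => by
      refine mem_disjointComplement_of_nonneg_le ?_ (hy0 n j) (hyle n j)
      rw [mem_disjointComplement_comm]
      refine mem_disjointComplement_of_nonneg_le ?_ (hy0 n i) (hyle n i)
      rw [mem_disjointComplement_comm]
      exact hx i hi j hj
    have hAy : ∀ n, A (y n) = 0 := fun n => by
      have hn : (0 : ℝ) < n + 1 := by positivity
      -- In `z = z ⊓ b + (z - b)⁺`, the first part is below a multiple of `s`, hence disjoint from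
      -- the entries in `T`. The second equals `(n + 1) (s - z / (n + 1))⁻`, hence is disjoint from
      -- `(s - z / (n + 1))⁺`, which dominates every perturbed entry in `S`.
      let b : E := ((n : ℝ) + 1) • s
      have hb : 0 ≤ b := smul_nonneg hn.le hs
      have hsplit : y n = Function.update (y n) r (z ⊓ b + (z - b)⁺) := by
        have : z ⊓ b + (z - b)⁺ = y n r := by
          rw [hyS' n r hrS, ← hz, posPart_def, ← sub_self b, ← sup_sub, ← add_sub_assoc,
            inf_add_sup, add_sub_cancel_right]
        rw [this, Function.update_eq_self]
      have hup : ∀ e, 0 ≤ e → ∀ i, 0 ≤ Function.update (y n) r e i := fun e he i => by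
        by_cases h : i = r
        · subst h
          simpa using he
        · simpa [h] using hy0 n i
      have hne : ∀ i, i ∈ S ∨ i ∈ T → i ≠ r := by
        rintro i (h | h) rfl
        exacts [hrS h, hrT h]
      rw [hsplit, A.map_update_add]
      refine (congrArg₂ (· + ·) ?_ ?_).trans (add_zero 0)
      · refine ih (insert r S) T (Finset.disjoint_insert_left.2 ⟨hrT, hST⟩)
          (by rwa [Finset.insert_union]) (Finset.mem_insert_of_mem hi) hj
          (hup _ (le_inf (hx0 r) hb)) fun i hi j hj => ?_
        rw [Function.update_of_ne (hne j (Or.inr hj))]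
        rcases Finset.mem_insert.1 hi with rfl | hi
        · rw [Function.update_self, mem_disjointComplement_comm]
          refine mem_disjointComplement_of_nonneg_le ?_ (le_inf (hx0 _) hb) inf_le_right
          refine Submodule.smul_mem _ _ (Submodule.sum_mem _ fun i hi => ?_)
          rw [hyS' n j fun h => Finset.disjoint_left.1 hST h hj, mem_disjointComplement_comm]
          exact hx i hi j hj
        · rw [Function.update_of_ne (hne i (Or.inl hi))]
          exact hy n i hi j hj
      · refine ih S (insert r T) (Finset.disjoint_insert_right.2 ⟨hrS, hST⟩)
          (by rwa [Finset.union_insert]) hi (Finset.mem_insert_of_mem hj)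
          (hup _ (posPart_nonneg _)) fun i hi j hj => ?_
        rw [Function.update_of_ne (hne i (Or.inl hi))]
        rcases Finset.mem_insert.1 hj with rfl | hj
        · rw [Function.update_self]
          let v : E := s - ((1 : ℝ) / (n + 1)) • z
          have hv : v⁻ ∈ disjointComplement v⁺ := by
            rw [mem_disjointComplement, abs_of_nonneg (posPart_nonneg _),
              abs_of_nonneg (negPart_nonneg _)]
            exact posPart_inf_negPart_eq_zero v
          have hzv : z - b = ((n : ℝ) + 1) • (-v) := by
            simp only [v, b]
            rw [neg_sub, smul_sub, smul_smul, mul_one_div_cancel hn.ne', one_smul]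
          have h1 : (z - b)⁺ ∈ disjointComplement v⁺ := by
            refine mem_disjointComplement_of_nonneg_le
              (Submodule.smul_mem _ ((n : ℝ) + 1) hv) (posPart_nonneg _) (sup_le ?_ ?_)
            · rw [hzv]
              exact smul_le_smul_of_nonneg_left (neg_le_negPart v) hn.le
            · exact smul_nonneg hn.le (negPart_nonneg v)
          rw [mem_disjointComplement_comm] at h1 ⊢
          refine mem_disjointComplement_of_nonneg_le h1 (hy0 n i) ?_
          rw [hyS n i hi]
          exact posPart_mono (sub_le_sub_right
            (Finset.single_le_sum (fun i _ => hx0 i) hi) _)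
        · rw [Function.update_of_ne (hne j (Or.inr hj))]
          exact hy n i hi j hj
    have hlim : Tendsto y atTop (𝓝 x) := by
      refine tendsto_pi_nhds.2 fun i => ?_
      by_cases h : i ∈ S
      · have h1 : Tendsto (fun n : ℕ => x i - ((1 : ℝ) / (n + 1)) • z) atTop (𝓝 (x i)) := by
          have := (tendsto_one_div_add_atTop_nhds_zero_nat (𝕜 := ℝ)).smul_const z
          simpa using tendsto_const_nhds.sub this
        have h2 := h1.sup_nhds (tendsto_const_nhds (x := (0 : E)))
        rw [sup_of_le_left (hx0 i)] at h2
        exact h2.congr fun n => (hyS n i h).symm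
      · exact tendsto_const_nhds.congr fun n => (hyS' n i h).symm
    exact tendsto_nhds_unique ((A.cont.tendsto x).comp hlim)
      (tendsto_const_nhds.congr fun n => (hAy n).symm)

/-- `A` vanishes at tuples that contain two disjoint vectors. -/
def IsOrthosymmetric (A : ContinuousMultilinearMap ℝ (fun _ : Fin m => E) F) : Prop :=
  ∀ (x : Fin m → E) (i j : Fin m), i ≠ j → |x i| ⊓ |x j| = 0 → A x = 0

/-- Positive and negative parts reduce to positive entries; then `{i}` and `{j}` are the initial
groups and all other entries are arbitrary. -/
theorem IsOrthogonallyAdditive.isOrthosymmetric (hP : IsOrthogonallyAdditive P)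
    (hA : IsAssociatedTo A.toMultilinearMap P) : IsOrthosymmetric A := by
  classical
  intro x i j hij hx
  change A.toMultilinearMap x = 0
  rw [A.toMultilinearMap.eq_sum_posPart_negPart x]
  refine Finset.sum_eq_zero fun s _ => smul_eq_zero_of_right _ ?_
  set y := s.piecewise (fun i => (x i)⁺) fun i => (x i)⁻ with hy
  have hy0 : ∀ i, 0 ≤ y i := fun i => by
    by_cases hi : i ∈ s <;> simp [hy, hi]
  have hyx : ∀ i, |y i| ≤ |x i| := fun i => by
    rw [abs_of_nonneg (hy0 i), ← posPart_add_negPart (x i)]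
    by_cases hi : i ∈ s <;> simp [hy, hi]
  refine hP.apply_eq_zero_of_disjoint_groups hA _ {i} {j} (by simpa using hij) rfl
    (Finset.mem_singleton_self i) (Finset.mem_singleton_self j) hy0 fun i' hi' j' hj' => ?_
  rw [Finset.mem_singleton.1 hi', Finset.mem_singleton.1 hj']
  exact abs_inf_abs_eq_zero_of_le hx (hyx i) (hyx j)

end OrthogonallyAdditive

/-! ### Orthosymmetric forms as an Arens symmetric family -/

section OrthosymmetricForms

variable {E : Type*} [NormedAddCommGroup E] [NormedSpace ℝ E] [Lattice E]

theorem IsOrthosymmetric.arensStep {n : ℕ}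
    {A : ContinuousMultilinearMap ℝ (fun _ : Fin (n + 1) => E) ℝ} (hA : IsOrthosymmetric A)
    (x'' : Bidual E) : IsOrthosymmetric (arensStep n x'' A) := by
  intro x i j hij hx
  have h : A.curryRight x = 0 := by
    ext e
    refine hA _ i.castSucc j.castSucc (fun h => hij (Fin.castSucc_injective _ h)) ?_
    simpa using hx
  exact (congrArg (fun φ : BanachDual E => x'' φ) h).trans (map_zero x'')

variable [IsOrderedAddMonoid E] [HasSolidNorm E]

/-- Domination belongs to the family because the modulus of a bilinear section exists only below a
positive form; it survives partial extension by `x''` with any `U` dominating `x''`. -/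
theorem isArensSymmetricFamily_orthosymmetric :
    IsArensSymmetricFamily fun n =>
      {A : ContinuousMultilinearMap ℝ (fun _ : Fin n => E) ℝ |
        IsSymmetricMultilinear A.toMultilinearMap ∧ IsOrthosymmetric A ∧
          ∃ C, IsDominatedBy A C} where
  step_mem n x'' A := by
    rintro ⟨hs, ho, C, hC⟩
    obtain ⟨U, hU⟩ := x''.exists_absLE
    exact ⟨hs.arensStep x'', ho.arensStep x'', _, hC.arensStep hU⟩
  step_comm n x'' y'' A := by
    rintro ⟨hs, ho, C, hC⟩
    refine arensStep_comm (fun x => isArensSymmetric_of_orthosymmetric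
      (C := C.curryRight.curryRight fun i => |x i|) (fun y z hy hz => ?_)
      (hs.curryRight_curryRight_comm x) fun y z hy hz hyz => ?_) x'' y''
    · have h1 := hC (Fin.snoc (Fin.snoc x y) z)
      have h2 : (fun i => |(Fin.snoc (Fin.snoc x y : Fin (n + 1) → E) z : Fin (n + 2) → E) i|) =
          Fin.snoc (Fin.snoc (fun i => |x i|) y : Fin (n + 1) → E) z := by
        ext i
        refine Fin.lastCases ?_ (fun i => Fin.lastCases ?_ (fun i => ?_) i) i
        · simpa using abs_of_nonneg hz
        · simpa using abs_of_nonneg hy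
        · simp
      rw [h2] at h1
      exact h1
    · refine ho (Fin.snoc (Fin.snoc x y) z) (Fin.last n).castSucc (Fin.last (n + 1))
        (Fin.castSucc_lt_last _).ne ?_
      simpa [abs_of_nonneg hy, abs_of_nonneg hz] using hyz

end OrthosymmetricForms

end

theorem mainTheorem12 {E : Type u} {F : Type v}
    [NormedAddCommGroup E] [NormedSpace ℝ E] [Lattice E] [IsOrderedAddMonoid E]
    [IsOrderedModule ℝ E] [HasSolidNorm E] [CompleteSpace E]
    [NormedAddCommGroup F] [NormedSpace ℝ F] [Lattice F] [IsOrderedAddMonoid F]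
    [IsOrderedModule ℝ F] [HasSolidNorm F] [CompleteSpace F]
    (m : ℕ) :
    (∀ (P : E → ℝ) (hP : IsRegularPolynomial m P), IsOrthogonallyAdditive P →
      ∀ x'' : Bidual E,
        OrderContinuousAt.{w} hP.arensExtension x'' ∧
        OneOrderContinuousAt.{w} hP.arensExtension x'' ∧
        TwoOrderContinuousAt.{w} hP.arensExtension x'') ∧
    (IsSymmetricallyArensRegular E →
      ∀ (P : E → F) (hP : IsRegularPolynomial m P),
      ∀ x'' : Bidual E,
        OrderContinuousAt.{w} hP.arensExtension x'' ∧
        OneOrderContinuousAt.{w} hP.arensExtension x'' ∧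
        TwoOrderContinuousAt.{w} hP.arensExtension x'') := by
  refine ⟨fun P hP hPo x'' => ?_, fun hE P hP x'' => ?_⟩
  · obtain ⟨C, hC⟩ := hP.exists_isDominatedBy
    have hA := hP.symmetricOperator_isAssociatedTo
    have ho := hPo.isOrthosymmetric hA
    refine isArensSymmetricFamily_orthosymmetric.orderContinuousAt hP (fun φ hφ =>
      ⟨fun σ x => ?_, fun x i j hij hx => ?_, _, hC.compBanachDual hφ⟩) x''
    · exact congrArg (fun t => φ t) (hA.1 σ x)
    · exact (congrArg (fun t => φ t) (ho x i j hij hx)).trans (map_zero φ)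
  · refine hE.isArensSymmetricFamily.orderContinuousAt hP (fun φ _ σ x => ?_) x''
    exact congrArg (fun t => φ t) (hP.symmetricOperator_isAssociatedTo.1 σ x)
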